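/- Let $\mathbb T^2=\mathbb R^2/\mathbb Z^2$ with normalised Lebesgue measure, $\hat f(k)=\int_{\mathbb T^2} f(x)e^{-2\pi i k\cdot x}\,dx$ for $k\in\mathbb Z^2$, let $2<p<3$, $\kappa>0$, and let $u_0\in L^2(\mathbb T^2)$ be real-valued. Let $e^{-t\mathcal L}$ be the Fourier multiplier with symbol $e^{-\kappa t|k|^4}$ (so $\mathcal L=\Delta^2$ for $\kappa=(2\pi)^4$, while $\kappa=1$ gives the symbol $e^{-t|k|^4}$). Consider $$\partial_t u+\mathcal L u=-\nabla\cdot\big(|\nabla u|^{p-2}\nabla u\big),\qquad u(0)=u_0. \tag{1}$$ For $T>0$, a function $u\in C([0,T];L^2(\mathbb T^2))$ with $\nabla u$ locally integrable is called a mild solution of (1) on $[0,T]$ if for all $0\le t\le T$ $$u(t)=e^{-t\mathcal L}u_0-\int_0^t \nabla\cdot e^{-(t-s)\mathcal L}\big(|\nabla u(s)|^{p-2}\nabla u(s)\big)\,ds$$ holds in $L^2(\mathbb T^2)$, the integral being a Bochner integral. Let $\tilde{\mathcal S}_T$ be the set of $u\in C([0,T];L^2(\mathbb T^2))$ with $\sup_{0<t\le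 T}t^{1/4}\|\nabla u(t)\|_{L^2}<\infty$, and let $T^*\in[0,\infty]$ be the supremum of all $T>0$ for which (1) has a mild solution on $[0,T]$ belonging to $\tilde{\mathcal S}_T$ (the maximal time of existence). Then $T^*>0$; there is a unique $u:[0,T^*)\to L^2(\mathbb T^2)$ that for every $0<T<T^*$ is a mild solution of (1) on $[0,T]$ belonging to $\tilde{\mathcal S}_T$; and if $T^*<\infty$, then $$\limsup_{t\to T^*_-}\|u(t)\|_{L^2(\mathbb T^2)}=\infty .$$ In other words, either this limit superior is infinite or $T^*=\infty$. -/

import Mathlib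

open MeasureTheory Set Filter Topology
open scoped ENNReal

noncomputable section

namespace ThinFilm

/-  On `ℝ/ℤ` use Mathlib's Haar probability measure `AddCircle.haarAddCircle` (it agrees with the
    Lebesgue measure), since Mathlib's Fourier analysis on the torus is stated for it.  -/
attribute [local instance] instMeasureSpaceUnitAddCircle

/-- The two-dimensional torus `ℝ² / ℤ²`, with its normalised Lebesgue (Haar) measure. -/
abbrev T2 : Type := UnitAddTorus (Fin 2)

/-- Vectors of `ℝ²` with the Euclidean norm. -/
abbrev E2 : Type := EuclideanSpace ℝ (Fin 2)

/-- Real-valued square integrable functions on the torus. -/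
abbrev L2 : Type := Lp ℝ 2 (volume : Measure T2)

/-- Complex-valued square integrable functions on the torus. -/
abbrev L2C : Type := Lp ℂ 2 (volume : Measure T2)

/-- The isometric inclusion of the real-valued into the complex-valued `L²` functions. -/
def complexify (f : L2) : L2C := Complex.ofRealCLM.compLp f

/-- The Fourier coefficient `∫ f(x) exp(-2πi k·x) dx` of a real-valued function. -/
def fourierCoeffR (f : T2 → ℝ) (k : Fin 2 → ℤ) : ℂ :=
  UnitAddTorus.mFourierCoeff (fun x => (f x : ℂ)) k

/-- `|k|⁴` for a frequency `k ∈ ℤ²`. -/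
def normPowFour (k : Fin 2 → ℤ) : ℝ := (∑ j, (k j : ℝ) ^ 2) ^ 2

/-- The integrable vector field `G` is the distributional gradient of `f`, that is
`Ĝ_j(k) = 2πi k_j f̂(k)` for all `k ∈ ℤ²` and `j` (equality tested on the characters). -/
structure IsWeakGradient (f : T2 → ℝ) (G : T2 → E2) : Prop where
  integrable : Integrable G volume
  coeff : ∀ (k : Fin 2 → ℤ) (j : Fin 2),
    fourierCoeffR (fun x => G x j) k = 2 * Real.pi * Complex.I * (k j : ℂ) * fourierCoeffR f k

/-- The distributional gradient of `f` is an integrable function. -/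
def HasWeakGradient (f : T2 → ℝ) : Prop := ∃ G : T2 → E2, IsWeakGradient f G

open Classical in
/-- The gradient `∇f` (unique up to null sets) when it is an integrable function. Every use below
comes with `HasWeakGradient f`; otherwise the value is the placeholder `0`. -/
def weakGradient (f : T2 → ℝ) : T2 → E2 :=
  if h : HasWeakGradient f then h.choose else 0

/-- The nonlinearity `F(G) = |G|^(p-2) G`, applied pointwise to a vector field. -/
def flux (p : ℝ) (G : T2 → E2) : T2 → E2 := fun x => ‖G x‖ ^ (p - 2) • G x

/-- The semigroup `e^{-τ𝓛}`: the Fourier multiplier with symbol `exp(-κ τ |k|⁴)`. For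
`κ = (2π)⁴` this is the semigroup of `𝓛 = Δ²` on `ℝ²/ℤ²`; for `κ = 1` it is the semigroup with the
normalised symbol `exp(-τ |k|⁴)`. The series converges in `L²` for `τ ≥ 0` and `f ∈ L²`. -/
def semigroup (κ τ : ℝ) (f : T2 → ℝ) : L2C :=
  ∑' k : Fin 2 → ℤ,
    (Real.exp (-(κ * τ * normPowFour k)) * fourierCoeffR f k : ℂ) • UnitAddTorus.mFourierLp 2 k

/-- The operator `∇ · e^{-τ𝓛}` on vector fields: the Fourier multiplier
`Φ̂(k) ↦ exp(-κ τ |k|⁴) 2πi k·Φ̂(k)`. The series converges in `L²` for `τ > 0` and `Φ ∈ L¹`. -/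
def divSemigroup (κ τ : ℝ) (Φ : T2 → E2) : L2C :=
  ∑' k : Fin 2 → ℤ,
    (Real.exp (-(κ * τ * normPowFour k)) *
      ∑ j, 2 * Real.pi * Complex.I * (k j : ℂ) * fourierCoeffR (fun x => Φ x j) k : ℂ) •
        UnitAddTorus.mFourierLp 2 k

/-- `u ∈ C([0,T]; L²)` is a mild solution on `[0,T]` of
`∂ₜu + 𝓛u = -∇·(|∇u|^(p-2) ∇u)`, `u(0) = u₀`:  `∇u` is locally integrable and, for all `t ∈ [0,T]`,
`u(t) = e^{-t𝓛} u₀ - ∫₀ᵗ ∇·e^{-(t-s)𝓛} (|∇u(s)|^(p-2) ∇u(s)) ds` in `L²`, with a Bochner integral. -/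
structure IsMildSolution (κ p T : ℝ) (u₀ : L2) (u : ℝ → L2) : Prop where
  continuousOn : ContinuousOn u (Icc 0 T)
  hasGradient : ∀ᵐ t ∂(volume.restrict (Ioo 0 T)), HasWeakGradient (u t)
  gradient_locallyIntegrable :
    LocallyIntegrableOn (fun t => ∫ x, ‖weakGradient (u t) x‖) (Ioo 0 T) volume
  flux_integrable : ∀ᵐ t ∂(volume.restrict (Ioo 0 T)),
    Integrable (flux p (weakGradient (u t))) volume
  intervalIntegrable : ∀ t ∈ Icc 0 T,
    IntervalIntegrable (fun s => divSemigroup κ (t - s) (flux p (weakGradient (u s)))) volume 0 t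
  equation : ∀ t ∈ Icc 0 T,
    complexify (u t) = semigroup κ t u₀ -
      ∫ s in (0 : ℝ)..t, divSemigroup κ (t - s) (flux p (weakGradient (u s)))

/-- `u ∈ 𝒮_T`: the gradient of `u(t)` is square integrable for `0 < t ≤ T`, and
`sup_{0 < t ≤ T} t^{1/4} ‖∇u(t)‖_{L²} < ∞`. -/
def InS (T : ℝ) (u : ℝ → L2) : Prop :=
  (∀ t ∈ Ioc 0 T, HasWeakGradient (u t)) ∧
    ⨆ t ∈ Ioc 0 T, ENNReal.ofReal (t ^ (1 / 4 : ℝ)) * eLpNorm (weakGradient (u t)) 2 volume < ⊤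

/-- `u` is a mild solution on `[0,T]` that lies in `C([0,T]; L²) ∩ 𝒮_T`. -/
def IsMildSolutionInS (κ p T : ℝ) (u₀ : L2) (u : ℝ → L2) : Prop :=
  IsMildSolution κ p T u₀ u ∧ InS T u

/-- The maximal time of existence `T* ∈ [0,∞]`: the supremum of all `T > 0` such that there is a
mild solution on `[0,T]` in `C([0,T]; L²) ∩ 𝒮_T`. -/
def maximalTime (κ p : ℝ) (u₀ : L2) : ℝ≥0∞ :=
  ⨆ T ∈ {T : ℝ | 0 < T ∧ ∃ u : ℝ → L2, IsMildSolutionInS κ p T u₀ u}, ENNReal.ofReal T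

/-- `u`, considered on `[0,T*)`, is the mild solution up to the maximal time `T*`. -/
def IsMaximalMildSolution (κ p : ℝ) (u₀ : L2) (u : ℝ → L2) : Prop :=
  ∀ T : ℝ, 0 < T → ENNReal.ofReal T < maximalTime κ p u₀ → IsMildSolutionInS κ p T u₀ u

end ThinFilm

end

noncomputable section

namespace ThinFilm

attribute [local instance] instMeasureSpaceUnitAddCircle

/-! For `p < 3` the equation is subcritical for `L²` data: the mild formulation is solved by a
contraction on a time interval whose length depends only on a bound for `‖u₀‖`. All estimates are
made on Fourier coefficients, with the gradient field `G = ∇u` as the unknown, measured by `sup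
t^(1/4) ‖G(t)‖`.

Since `p - 1 < 2`, Hölder and Jensen put the flux `|G|^(p-2) G` in `L¹`, with norm at most
`‖G‖^(p-1)`. The coefficients of its divergence are therefore at most a constant times `|k|
s^(-(p-1)/4)`. For `0 ≤ a ≤ 1` the inequality `exp(-x) ≤ x^(-a)` gains `|k|^(-4a)` from the
semigroup at the price of `(t-s)^(-a)`. The gradient of the Duhamel term is square integrable if `∑
|k|^(4-8a)` converges over the nonzero `k ∈ ℤ²`, that is if `a > 3/4`. It is smaller than `t^(-1/4)`
for short times if `a < (6-p)/4`. This window is nonempty exactly when `p < 3`, and `p > 2` keeps it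
below `1`. Its midpoint is `gradExp`, which leaves the small factor `T^((3-p)/8)`.

With that factor `IsDuhamelStep.norm_sub_le` is a contraction estimate. It gives local existence
(`exists_isCoeffSolution`) and, iterated over short intervals, uniqueness (`IsCoeffSolution.eq`).
The translation to and from Bochner integrals is `IsCoeffSolution.isMildSolutionInS` and
`IsMildSolutionInS.exists_isCoeffSolution`.

Uniqueness glues all solutions into one maximal solution. If its `L²` norm stayed bounded near a
finite `T*`, a restart shortly before `T*` would live for a time `δ` depending only on that bound;
`IsCoeffSolution.glue` would then give a solution beyond `T*`, a contradiction. -/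

instance : IsProbabilityMeasure (volume : Measure UnitAddCircle) :=
  inferInstanceAs (IsProbabilityMeasure AddCircle.haarAddCircle)

/-! ### Fourier coefficients of real functions: Parseval, realisation, uniqueness. -/

theorem fourierCoeffR_congr_ae {f g : T2 → ℝ} (h : f =ᵐ[volume] g) (k : Fin 2 → ℤ) :
    fourierCoeffR f k = fourierCoeffR g k := by
  refine integral_congr_ae ?_
  filter_upwards [h] with x hx
  simp [hx]

theorem norm_mFourier_apply (k : Fin 2 → ℤ) (x : T2) : ‖UnitAddTorus.mFourier k x‖ = 1 := by
  simp only [UnitAddTorus.mFourier, fourier_apply, ContinuousMap.coe_mk, norm_prod,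
    Circle.norm_coe, Finset.prod_const_one]

theorem integrable_mFourier_smul {f : T2 → ℝ} (hf : Integrable f volume) (k : Fin 2 → ℤ) :
    Integrable (fun x => UnitAddTorus.mFourier k x • (f x : ℂ)) volume := by
  refine (hf.ofReal (𝕜 := ℂ)).bdd_mul (c := 1)
    (UnitAddTorus.mFourier k).continuous.aestronglyMeasurable ?_
  exact Eventually.of_forall fun x => (norm_mFourier_apply k x).le

theorem norm_fourierCoeffR_le (f : T2 → ℝ) (k : Fin 2 → ℤ) :
    ‖fourierCoeffR f k‖ ≤ ∫ x, |f x| := by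
  refine (norm_integral_le_integral_norm _).trans_eq ?_
  refine integral_congr_ae (Eventually.of_forall fun x => ?_)
  simp [norm_mFourier_apply]

theorem fourierCoeffR_sub {f g : T2 → ℝ} (hf : Integrable f volume) (hg : Integrable g volume)
    (k : Fin 2 → ℤ) :
    fourierCoeffR (fun x => f x - g x) k = fourierCoeffR f k - fourierCoeffR g k := by
  unfold fourierCoeffR UnitAddTorus.mFourierCoeff
  rw [← integral_sub (integrable_mFourier_smul hf _) (integrable_mFourier_smul hg _)]
  refine integral_congr_ae (Eventually.of_forall fun x => ?_)
  simp [mul_sub]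

theorem fourierCoeffR_neg_freq (f : T2 → ℝ) (k : Fin 2 → ℤ) :
    fourierCoeffR f (-k) = (starRingEnd ℂ) (fourierCoeffR f k) := by
  unfold fourierCoeffR UnitAddTorus.mFourierCoeff
  rw [← integral_conj]
  refine integral_congr_ae (Eventually.of_forall fun x => ?_)
  simp [UnitAddTorus.mFourier_neg]

theorem coeFn_complexify (f : L2) : complexify f =ᵐ[volume] fun x => (f x : ℂ) :=
  Complex.ofRealCLM.coeFn_compLp f

theorem mFourierCoeff_complexify (f : L2) (k : Fin 2 → ℤ) :
    UnitAddTorus.mFourierCoeff (complexify f) k = fourierCoeffR f k := by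
  refine integral_congr_ae ?_
  filter_upwards [coeFn_complexify f] with x hx
  simp [hx]

theorem complexify_injective : Function.Injective complexify := by
  intro f g h
  refine Lp.ext ?_
  filter_upwards [coeFn_complexify f, coeFn_complexify g] with x hf hg
  have : ((f x : ℝ) : ℂ) = g x := by rw [← hf, ← hg, h]
  exact_mod_cast this

theorem L2C_ext {f g : L2C}
    (h : ∀ k, UnitAddTorus.mFourierCoeff f k = UnitAddTorus.mFourierCoeff g k) : f = g := by
  apply UnitAddTorus.mFourierBasis.repr.injective
  ext k
  rw [UnitAddTorus.mFourierBasis_repr, UnitAddTorus.mFourierBasis_repr, h]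

theorem L2_ext {f g : L2} (h : ∀ k, fourierCoeffR f k = fourierCoeffR g k) : f = g := by
  apply complexify_injective
  apply L2C_ext
  intro k
  rw [mFourierCoeff_complexify, mFourierCoeff_complexify, h]

theorem hasSum_sq_fourierCoeffR (f : L2) :
    HasSum (fun k => ‖fourierCoeffR f k‖ ^ 2) (∫ x, f x ^ 2) := by
  have := UnitAddTorus.hasSum_sq_mFourierCoeff (complexify f)
  simp only [mFourierCoeff_complexify] at this
  convert this using 1
  refine integral_congr_ae ?_
  filter_upwards [coeFn_complexify f] with x hx
  simp [hx]

theorem integral_sq_eq_norm_sq (f : L2) : ∫ x, f x ^ 2 = ‖f‖ ^ 2 := by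
  rw [← real_inner_self_eq_norm_sq, L2.inner_def]
  simp [sq]

/-- A square summable family of complex numbers is the family of Fourier coefficients of a square
integrable function. -/
theorem exists_L2C_of_summable {c : (Fin 2 → ℤ) → ℂ} (hc : Summable fun k => ‖c k‖ ^ 2) :
    ∃ f : L2C, (∀ k, UnitAddTorus.mFourierCoeff f k = c k) ∧
      HasSum (fun k => c k • UnitAddTorus.mFourierLp 2 k) f := by
  have hm : Memℓp c 2 := memℓp_gen (by simpa using hc)
  refine ⟨UnitAddTorus.mFourierBasis.repr.symm ⟨c, hm⟩, fun k => ?_, ?_⟩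
  · rw [← UnitAddTorus.mFourierBasis_repr]
    simp
  · have := UnitAddTorus.mFourierBasis.hasSum_repr_symm ⟨c, hm⟩
    simpa [UnitAddTorus.coe_mFourierBasis] using this

/-- Take the real part of the complex function with coefficients `c`. Its coefficient at `k` is the
mean of `c k` and the conjugate of `c (-k)`, which the symmetry makes equal to `c k`. -/
theorem exists_L2_of_hermitian {c : (Fin 2 → ℤ) → ℂ} (hc : Summable fun k => ‖c k‖ ^ 2)
    (hs : ∀ k, c (-k) = (starRingEnd ℂ) (c k)) :
    ∃ f : L2, ∀ k, fourierCoeffR f k = c k := by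
  obtain ⟨F, hF, -⟩ := exists_L2C_of_summable hc
  have hFi : Integrable F volume := (Lp.memLp F).integrable (by norm_num)
  refine ⟨Complex.reCLM.compLp F, fun k => ?_⟩
  have hi : ∀ k, Integrable (fun x => UnitAddTorus.mFourier k x • F x) volume := fun k =>
    hFi.bdd_mul (c := 1) (UnitAddTorus.mFourier k).continuous.aestronglyMeasurable
      (Eventually.of_forall fun x => (norm_mFourier_apply k x).le)
  have h1 : fourierCoeffR (Complex.reCLM.compLp F) k =
      ∫ x, (1 / 2 : ℂ) * (UnitAddTorus.mFourier (-k) x • F x +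
        (starRingEnd ℂ) (UnitAddTorus.mFourier k x • F x)) := by
    refine integral_congr_ae ?_
    filter_upwards [Complex.reCLM.coeFn_compLp F] with x hx
    rw [hx]
    simp only [Complex.reCLM_apply, UnitAddTorus.mFourier_neg, smul_eq_mul, map_mul]
    rw [Complex.re_eq_add_conj]
    ring
  have hconj : Integrable (fun x => (starRingEnd ℂ) (UnitAddTorus.mFourier k x • F x)) volume :=
    (Complex.conjCLE.toContinuousLinearMap.integrable_comp (hi k))
  rw [h1, integral_const_mul, integral_add (hi _) hconj, integral_conj]
  have e1 : ∫ x, UnitAddTorus.mFourier (-k) x • F x = c k := hF k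
  have e2 : ∫ x, UnitAddTorus.mFourier k x • F x = c (-k) := by
    rw [← hF (-k)]; unfold UnitAddTorus.mFourierCoeff; rw [neg_neg]
  rw [e1, e2, hs]
  simp
  ring

/-- An integrable function is determined by its Fourier coefficients. -/
theorem ae_eq_zero_of_fourierCoeffR_eq_zero {f : T2 → ℝ} (hf : Integrable f volume)
    (h : ∀ k, fourierCoeffR f k = 0) : f =ᵐ[volume] 0 := by
  have hfc : Integrable (fun x => (f x : ℂ)) volume := hf.ofReal
  have hint : ∀ g : C(T2, ℂ), Integrable (fun x => g x * (f x : ℂ)) volume := fun g =>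
    hfc.bdd_mul (c := ‖g‖) g.continuous.aestronglyMeasurable
      (Eventually.of_forall fun x => g.norm_coe_le_norm x)
  let L : C(T2, ℂ) →ₗ[ℂ] ℂ :=
    { toFun := fun g => ∫ x, g x * (f x : ℂ)
      map_add' := fun g g' => by
        rw [← integral_add (hint g) (hint g')]
        simp [add_mul]
      map_smul' := fun c g => by
        simp [mul_assoc, integral_const_mul] }
  have hL : Continuous L := by
    refine AddMonoidHomClass.continuous_of_bound L (∫ x, ‖(f x : ℂ)‖) fun g => ?_
    rw [mul_comm, ← integral_const_mul]
    refine norm_integral_le_of_norm_le (hfc.norm.const_mul _) (Eventually.of_forall fun x => ?_)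
    rw [norm_mul]
    gcongr
    exact g.norm_coe_le_norm x
  -- The functional `g ↦ ∫ g f` is continuous for the sup norm and kills every character, and the
  -- span of the characters is dense.
  have hzero : ∀ g : C(T2, ℂ), L g = 0 := by
    have hspan : Submodule.span ℂ (range <| UnitAddTorus.mFourier (d := Fin 2)) ≤
        LinearMap.ker L := by
      rw [Submodule.span_le]
      rintro _ ⟨k, rfl⟩
      have := h (-k)
      unfold fourierCoeffR UnitAddTorus.mFourierCoeff at this
      rw [neg_neg] at this
      exact this
    have hclosed : IsClosed (LinearMap.ker L : Set C(T2, ℂ)) := by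
      have : (LinearMap.ker L : Set C(T2, ℂ)) = L ⁻¹' {0} := by ext; simp
      rw [this]
      exact isClosed_singleton.preimage hL
    have := Submodule.topologicalClosure_minimal _ hspan hclosed
    rw [UnitAddTorus.span_mFourier_closure_eq_top] at this
    exact fun g => this (Submodule.mem_top (x := g))
  have hreal : ∀ g : C(T2, ℝ), ∫ x, g x * f x = 0 := by
    intro g
    have := hzero ⟨fun x => (g x : ℂ), by fun_prop⟩
    have h2 : (∫ x, ((g x * f x : ℝ) : ℂ)) = 0 := by
      simpa [L] using this
    rw [integral_complex_ofReal] at h2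
    exact_mod_cast h2
  -- Closed sets suffice, and their indicators are bounded pointwise limits of continuous functions.
  refine ae_eq_zero_of_forall_setIntegral_isClosed_eq_zero hf fun s hs => ?_
  have hlim : Tendsto (fun n : ℕ => ∫ x, ((hs.apprSeq n x : NNReal) : ℝ) * f x) atTop
      (𝓝 (∫ x, s.indicator f x)) := by
    refine tendsto_integral_of_dominated_convergence (fun x => ‖f x‖) (fun n => ?_) hf.norm
      (fun n => Eventually.of_forall fun x => ?_) (Eventually.of_forall fun x => ?_)
    · exact (NNReal.continuous_coe.comp (hs.apprSeq n).continuous).aestronglyMeasurable.mul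
        hf.aestronglyMeasurable
    · rw [norm_mul]
      refine mul_le_of_le_one_left (norm_nonneg _) ?_
      have := HasOuterApproxClosed.apprSeq_apply_le_one hs n x
      simpa using this
    · have := tendsto_pi_nhds.1 (HasOuterApproxClosed.tendsto_apprSeq hs) x
      have h3 : Tendsto (fun n => ((hs.apprSeq n x : NNReal) : ℝ)) atTop
          (𝓝 ((s.indicator (fun _ => (1 : NNReal)) x : NNReal) : ℝ)) :=
        (NNReal.continuous_coe.tendsto _).comp this
      have h4 := h3.mul_const (f x)
      convert h4 using 2
      by_cases hx : x ∈ s <;> simp [hx]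
  rw [integral_indicator hs.measurableSet] at hlim
  refine tendsto_nhds_unique hlim ?_
  have : ∀ n : ℕ, ∫ x, ((hs.apprSeq n x : NNReal) : ℝ) * f x = 0 := fun n =>
    hreal ⟨fun x => ((hs.apprSeq n x : NNReal) : ℝ),
      NNReal.continuous_coe.comp (hs.apprSeq n).continuous⟩
  simp [this]

/-! ### Frequencies, square integrable vector fields and weak gradients. -/

/-- Square integrable vector fields on the torus. -/
abbrev V2 : Type := Lp E2 2 (volume : Measure T2)

/-- `|k|²` for a frequency `k ∈ ℤ²`. -/
def normSq (k : Fin 2 → ℤ) : ℝ := ∑ j, (k j : ℝ) ^ 2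

theorem normSq_nonneg (k : Fin 2 → ℤ) : 0 ≤ normSq k :=
  Finset.sum_nonneg fun _ _ => sq_nonneg _

theorem normPowFour_eq (k : Fin 2 → ℤ) : normPowFour k = normSq k ^ 2 := rfl

theorem normSq_eq_zero {k : Fin 2 → ℤ} : normSq k = 0 ↔ k = 0 := by
  unfold normSq
  rw [Finset.sum_eq_zero_iff_of_nonneg fun _ _ => sq_nonneg _]
  simp [funext_iff]

theorem one_le_normSq {k : Fin 2 → ℤ} (hk : k ≠ 0) : 1 ≤ normSq k := by
  have h0 : normSq k ≠ 0 := fun h => hk (normSq_eq_zero.1 h)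
  have h1 : normSq k = ((∑ j, k j ^ 2 : ℤ) : ℝ) := by simp [normSq]
  have h2 := normSq_nonneg k
  rw [h1] at h0 h2 ⊢
  have h3 : (∑ j, k j ^ 2 : ℤ) ≠ 0 := by exact_mod_cast h0
  have h4 : 0 ≤ (∑ j, k j ^ 2 : ℤ) := by exact_mod_cast h2
  have : 1 ≤ (∑ j, k j ^ 2 : ℤ) := by omega
  exact_mod_cast this

/-- The symbol of `∂_j`. -/
def dsym (k : Fin 2 → ℤ) (j : Fin 2) : ℂ := 2 * Real.pi * Complex.I * (k j : ℂ)

theorem norm_dsym (k : Fin 2 → ℤ) (j : Fin 2) : ‖dsym k j‖ = 2 * Real.pi * |(k j : ℝ)| := by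
  simp [dsym, abs_of_pos Real.pi_pos]

theorem dsym_neg (k : Fin 2 → ℤ) (j : Fin 2) : dsym (-k) j = (starRingEnd ℂ) (dsym k j) := by
  simp [dsym, Complex.conj_ofNat]

theorem norm_dsym_le (k : Fin 2 → ℤ) (j : Fin 2) : ‖dsym k j‖ ≤ 2 * Real.pi * √(normSq k) := by
  rw [norm_dsym, ← Real.sqrt_sq_eq_abs]
  gcongr
  exact Finset.single_le_sum (f := fun j => (k j : ℝ) ^ 2) (fun _ _ => sq_nonneg _)
    (Finset.mem_univ j)

theorem sum_norm_dsym_sq (k : Fin 2 → ℤ) :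
    ∑ j, ‖dsym k j‖ ^ 2 = (2 * Real.pi) ^ 2 * normSq k := by
  simp [norm_dsym, normSq, mul_pow]
  ring

theorem V2.integrable (G : V2) : Integrable G volume := (Lp.memLp G).integrable (by norm_num)

theorem V2.integrable_coord {G : T2 → E2} (h : Integrable G volume) (j : Fin 2) :
    Integrable (fun x => G x j) volume :=
  (EuclideanSpace.proj (𝕜 := ℝ) j).integrable_comp h

theorem L2.integrable (f : L2) : Integrable f volume := (Lp.memLp f).integrable (by norm_num)

/-- The `j`-th component of a vector field. -/
def V2.coord (j : Fin 2) (G : V2) : L2 := (EuclideanSpace.proj (𝕜 := ℝ) j).compLp G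

theorem V2.coeFn_coord (j : Fin 2) (G : V2) : V2.coord j G =ᵐ[volume] fun x => G x j :=
  (EuclideanSpace.proj (𝕜 := ℝ) j).coeFn_compLp G

theorem V2.integral_sq (G : V2) : ∫ x, ‖G x‖ ^ 2 = ‖G‖ ^ 2 := by
  rw [← real_inner_self_eq_norm_sq, L2.inner_def]
  simp

theorem V2.norm_sq_eq (G : V2) : ‖G‖ ^ 2 = ∑ j, ‖V2.coord j G‖ ^ 2 := by
  rw [← V2.integral_sq]
  simp_rw [← integral_sq_eq_norm_sq]
  rw [← integral_finsetSum]
  · refine integral_congr_ae ?_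
    filter_upwards [V2.coeFn_coord 0 G, V2.coeFn_coord 1 G] with x h0 h1
    rw [EuclideanSpace.norm_sq_eq]
    simp [Fin.sum_univ_two, h0, h1]
  · intro j _
    exact (Lp.memLp (V2.coord j G)).integrable_sq

theorem V2.fourierCoeffR_coord (j : Fin 2) (G : V2) (k : Fin 2 → ℤ) :
    fourierCoeffR (V2.coord j G) k = fourierCoeffR (fun x => G x j) k :=
  fourierCoeffR_congr_ae (V2.coeFn_coord j G) k

/-- Parseval's identity for gradients. -/
theorem IsWeakGradient.hasSum_norm_sq {f : T2 → ℝ} {G : V2} (h : IsWeakGradient f G) :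
    HasSum (fun k => (2 * Real.pi) ^ 2 * normSq k * ‖fourierCoeffR f k‖ ^ 2) (‖G‖ ^ 2) := by
  rw [V2.norm_sq_eq]
  have := hasSum_sum (s := Finset.univ) fun j (_ : j ∈ Finset.univ) =>
    hasSum_sq_fourierCoeffR (V2.coord j G)
  simp only [integral_sq_eq_norm_sq] at this
  convert this using 2 with k
  rw [← sum_norm_dsym_sq, Finset.sum_mul]
  refine Finset.sum_congr rfl fun j _ => ?_
  rw [V2.fourierCoeffR_coord, h.coeff k j, ← mul_pow, ← norm_mul]
  rfl

theorem ae_eq_of_fourierCoeffR_eq {f g : T2 → ℝ} (hf : Integrable f volume)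
    (hg : Integrable g volume) (h : ∀ k, fourierCoeffR f k = fourierCoeffR g k) :
    f =ᵐ[volume] g := by
  have := ae_eq_zero_of_fourierCoeffR_eq_zero (hf.sub hg) (fun k => by
    have := fourierCoeffR_sub hf hg k
    rw [h k, sub_self] at this
    exact this)
  filter_upwards [this] with x hx
  simpa [sub_eq_zero] using hx

theorem IsWeakGradient.ae_eq {f : T2 → ℝ} {G H : T2 → E2} (hG : IsWeakGradient f G)
    (hH : IsWeakGradient f H) : G =ᵐ[volume] H := by
  have key : ∀ j, (fun x => G x j) =ᵐ[volume] fun x => H x j := fun j =>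
    ae_eq_of_fourierCoeffR_eq (V2.integrable_coord hG.integrable j)
      (V2.integrable_coord hH.integrable j) fun k => by rw [hG.coeff, hH.coeff]
  filter_upwards [key 0, key 1] with x h0 h1
  ext j
  fin_cases j
  · exact h0
  · exact h1

theorem IsWeakGradient.congr_right {f : T2 → ℝ} {G H : T2 → E2} (hG : IsWeakGradient f G)
    (h : G =ᵐ[volume] H) : IsWeakGradient f H where
  integrable := hG.integrable.congr h
  coeff k j := by
    rw [← hG.coeff k j]
    refine fourierCoeffR_congr_ae ?_ k
    filter_upwards [h] with x hx
    rw [hx]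

theorem HasWeakGradient.isWeakGradient {f : T2 → ℝ} (h : HasWeakGradient f) :
    IsWeakGradient f (weakGradient f) := by
  unfold weakGradient
  rw [dif_pos h]
  exact h.choose_spec

/-- Integrable fields are determined by their coefficients, so the arbitrary choice inside
`weakGradient` is harmless and any convenient representative may replace it. -/
theorem IsWeakGradient.weakGradient_ae_eq {f : T2 → ℝ} {G : T2 → E2} (h : IsWeakGradient f G) :
    weakGradient f =ᵐ[volume] G :=
  (HasWeakGradient.isWeakGradient ⟨G, h⟩).ae_eq h

theorem IsWeakGradient.sub {f g : L2} {G H : V2} (hG : IsWeakGradient f G)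
    (hH : IsWeakGradient g H) : IsWeakGradient (f - g : L2) (G - H : V2) where
  integrable := V2.integrable _
  coeff k j := by
    have e1 : fourierCoeffR (fun x => (G - H : V2) x j) k =
        fourierCoeffR (fun x => G x j - H x j) k := by
      refine fourierCoeffR_congr_ae ?_ k
      filter_upwards [Lp.coeFn_sub G H] with x hx
      rw [hx]
      rfl
    have e2 : fourierCoeffR (f - g : L2) k = fourierCoeffR (fun x => f x - g x) k :=
      fourierCoeffR_congr_ae (Lp.coeFn_sub f g) k
    rw [e1, e2, fourierCoeffR_sub (V2.integrable_coord hG.integrable j)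
      (V2.integrable_coord hH.integrable j), fourierCoeffR_sub (L2.integrable f) (L2.integrable g),
      hG.coeff, hH.coeff]
    ring

/-- Each partial derivative is built from its symbol: the hypothesis makes its coefficients square
summable, and the symmetry of `dsym` under `k ↦ -k` makes the resulting function real. -/
theorem exists_isWeakGradient {f : T2 → ℝ}
    (hs : Summable fun k => normSq k * ‖fourierCoeffR f k‖ ^ 2) :
    ∃ G : V2, IsWeakGradient f G := by
  have hj : ∀ j, ∃ g : L2, ∀ k, fourierCoeffR g k = dsym k j * fourierCoeffR f k := by
    intro j
    refine exists_L2_of_hermitian ?_ fun k => ?_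
    · refine (hs.mul_left ((2 * Real.pi) ^ 2)).of_nonneg_of_le (fun k => sq_nonneg _) fun k => ?_
      rw [norm_mul, mul_pow, ← mul_assoc]
      gcongr
      refine (pow_le_pow_left₀ (norm_nonneg _) (norm_dsym_le k j) 2).trans_eq ?_
      rw [mul_pow, Real.sq_sqrt (normSq_nonneg k)]
    · rw [dsym_neg, fourierCoeffR_neg_freq, map_mul]
  choose g hg using hj
  have hmem : MemLp (fun x => (WithLp.toLp 2 (fun j => g j x) : E2)) 2 volume := by
    have h0 := MemLp.of_eval_piLp (q := 2) (f := fun x => (WithLp.toLp 2 (fun j => g j x) : E2))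
      (p := 2) (μ := volume) fun j => Lp.memLp (g j)
    exact h0
  refine ⟨hmem.toLp _, V2.integrable _, fun k j => ?_⟩
  have : fourierCoeffR (fun x => hmem.toLp _ x j) k = fourierCoeffR (g j) k := by
    refine fourierCoeffR_congr_ae ?_ k
    filter_upwards [hmem.coeFn_toLp] with x hx
    rw [hx]
  rw [this, hg]
  rfl

/-! ### The nonlinearity as a locally Lipschitz map from `L²` to `L¹`. -/

/-- For `|b| ≤ |a|` the difference is `|a|^α (a - b) + (|a|^α - |b|^α) b`. The second term is at
most `|b|^α (|a| - |b|)`, because `|a|^α |b| ≤ |b|^α |a|`; that inequality amounts to monotonicity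
of `x^(1-α)` and needs `α ≤ 1`. -/
theorem norm_rpow_smul_sub_le {α : ℝ} (h0 : 0 < α) (h1 : α ≤ 1) (a b : E2) :
    ‖‖a‖ ^ α • a - ‖b‖ ^ α • b‖ ≤ (‖a‖ ^ α + ‖b‖ ^ α) * ‖a - b‖ := by
  wlog hab : ‖b‖ ≤ ‖a‖ generalizing a b
  · have := this b a (le_of_not_ge hab)
    rw [norm_sub_rev, norm_sub_rev a b, add_comm]
    exact this
  have hb := norm_nonneg b
  have ha := norm_nonneg a
  have e : ‖a‖ ^ α • a - ‖b‖ ^ α • b = ‖a‖ ^ α • (a - b) + (‖a‖ ^ α - ‖b‖ ^ α) • b := by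
    module
  have hmono : ‖b‖ ^ α ≤ ‖a‖ ^ α := Real.rpow_le_rpow hb hab h0.le
  have key : ‖a‖ ^ α * ‖b‖ ≤ ‖b‖ ^ α * ‖a‖ := by
    have eb : ‖b‖ = ‖b‖ ^ α * ‖b‖ ^ (1 - α) := by
      rw [← Real.rpow_add_of_nonneg hb h0.le (by linarith)]; simp
    have ea : ‖a‖ = ‖a‖ ^ α * ‖a‖ ^ (1 - α) := by
      rw [← Real.rpow_add_of_nonneg ha h0.le (by linarith)]; simp
    have hm : ‖b‖ ^ (1 - α) ≤ ‖a‖ ^ (1 - α) := Real.rpow_le_rpow hb hab (by linarith)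
    calc ‖a‖ ^ α * ‖b‖ = ‖a‖ ^ α * (‖b‖ ^ α * ‖b‖ ^ (1 - α)) := by rw [← eb]
      _ ≤ ‖a‖ ^ α * (‖b‖ ^ α * ‖a‖ ^ (1 - α)) := by gcongr
      _ = ‖b‖ ^ α * (‖a‖ ^ α * ‖a‖ ^ (1 - α)) := by ring
      _ = ‖b‖ ^ α * ‖a‖ := by rw [← ea]
  have htri : ‖a‖ - ‖b‖ ≤ ‖a - b‖ := norm_sub_norm_le a b
  rw [e]
  refine (norm_add_le _ _).trans ?_
  rw [norm_smul, norm_smul, Real.norm_of_nonneg (Real.rpow_nonneg ha _),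
    Real.norm_of_nonneg (sub_nonneg.2 hmono)]
  have := mul_le_mul_of_nonneg_left htri (Real.rpow_nonneg hb α)
  nlinarith

theorem V2.integrable_norm_sq (G : V2) : Integrable (fun x => ‖G x‖ ^ 2) volume :=
  (Lp.memLp G).integrable_norm_pow (by norm_num)

theorem V2.aestronglyMeasurable_norm_rpow (G : V2) (α : ℝ) :
    AEStronglyMeasurable (fun x => ‖G x‖ ^ α) volume :=
  ((Lp.aestronglyMeasurable G).norm.aemeasurable.pow_const α).aestronglyMeasurable

theorem V2.integrable_norm_sq_rpow (G : V2) {α : ℝ} (h0 : 0 < α) (h1 : α ≤ 1) :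
    Integrable (fun x => (‖G x‖ ^ 2) ^ α) volume := by
  refine ((integrable_const (1 : ℝ)).add (V2.integrable_norm_sq G)).mono'
    ((V2.integrable_norm_sq G).aestronglyMeasurable.aemeasurable.pow_const α).aestronglyMeasurable
    (Eventually.of_forall fun x => ?_)
  have hx : 0 ≤ ‖G x‖ ^ 2 := by positivity
  rw [Real.norm_of_nonneg (Real.rpow_nonneg hx _)]
  simp only [Pi.add_apply]
  calc (‖G x‖ ^ 2) ^ α ≤ (1 + ‖G x‖ ^ 2) ^ α := Real.rpow_le_rpow hx (by linarith) h0.le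
    _ ≤ (1 + ‖G x‖ ^ 2) ^ (1 : ℝ) := Real.rpow_le_rpow_of_exponent_le (by linarith) h1
    _ = 1 + ‖G x‖ ^ 2 := Real.rpow_one _

theorem V2.memLp_norm_rpow (G : V2) {α : ℝ} (h0 : 0 < α) (h1 : α ≤ 1) :
    MemLp (fun x => ‖G x‖ ^ α) 2 volume := by
  rw [memLp_two_iff_integrable_sq (V2.aestronglyMeasurable_norm_rpow G α)]
  refine (V2.integrable_norm_sq_rpow G h0 h1).congr (Eventually.of_forall fun x => ?_)
  simp only
  rw [← Real.rpow_natCast, ← Real.rpow_natCast, ← Real.rpow_mul (norm_nonneg _),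
    ← Real.rpow_mul (norm_nonneg _), mul_comm]

theorem V2.integrable_norm_rpow_mul (G D : V2) {α : ℝ} (h0 : 0 < α) (h1 : α ≤ 1) :
    Integrable (fun x => ‖G x‖ ^ α * ‖D x‖) volume :=
  (V2.memLp_norm_rpow G h0 h1).integrable_mul (Lp.memLp D).norm

/-- Hölder's and Jensen's inequality combined. -/
theorem V2.integral_norm_rpow_mul_le (G D : V2) {α : ℝ} (h0 : 0 < α) (h1 : α ≤ 1) :
    ∫ x, ‖G x‖ ^ α * ‖D x‖ ≤ ‖G‖ ^ α * ‖D‖ := by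
  have hold := integral_mul_le_Lp_mul_Lq_of_nonneg (μ := (volume : Measure T2))
    (f := fun x => ‖G x‖ ^ α) (g := fun x => ‖D x‖) Real.HolderConjugate.two_two
    (Eventually.of_forall fun x => Real.rpow_nonneg (norm_nonneg _) _)
    (Eventually.of_forall fun x => norm_nonneg _)
    (by simpa using V2.memLp_norm_rpow G h0 h1) (by simpa using (Lp.memLp D).norm)
  refine hold.trans ?_
  have hD : (∫ x, ‖D x‖ ^ (2 : ℝ)) ^ (1 / 2 : ℝ) = ‖D‖ := by
    simp_rw [Real.rpow_two]
    rw [V2.integral_sq, ← Real.sqrt_eq_rpow, Real.sqrt_sq (norm_nonneg _)]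
  have hG : (∫ x, (‖G x‖ ^ α) ^ (2 : ℝ)) ^ (1 / 2 : ℝ) ≤ ‖G‖ ^ α := by
    have e : ∀ x, (‖G x‖ ^ α) ^ (2 : ℝ) = (‖G x‖ ^ 2) ^ α := fun x => by
      rw [← Real.rpow_natCast, ← Real.rpow_mul (norm_nonneg _),
        ← Real.rpow_mul (norm_nonneg _), mul_comm]
      norm_cast
    simp_rw [e]
    have jensen : ∫ x, (‖G x‖ ^ 2) ^ α ≤ (∫ x, ‖G x‖ ^ 2) ^ α :=
      (Real.concaveOn_rpow h0.le h1).le_map_integral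
        (Real.continuous_rpow_const h0.le).continuousOn isClosed_Ici
        (Eventually.of_forall fun x => sq_nonneg ‖G x‖) (V2.integrable_norm_sq G)
        (V2.integrable_norm_sq_rpow G h0 h1)
    rw [V2.integral_sq] at jensen
    calc (∫ x, (‖G x‖ ^ 2) ^ α) ^ (1 / 2 : ℝ) ≤ ((‖G‖ ^ 2) ^ α) ^ (1 / 2 : ℝ) :=
          Real.rpow_le_rpow (integral_nonneg fun x => by positivity) jensen (by norm_num)
      _ = ‖G‖ ^ α := by
          rw [← Real.rpow_natCast, ← Real.rpow_mul (norm_nonneg _),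
            ← Real.rpow_mul (norm_nonneg _)]
          congr 1
          push_cast
          ring
  rw [hD]
  gcongr

theorem flux_congr_ae (p : ℝ) {G H : T2 → E2} (h : G =ᵐ[volume] H) :
    flux p G =ᵐ[volume] flux p H := by
  filter_upwards [h] with x hx
  simp [flux, hx]

theorem integrable_flux {p : ℝ} (h2 : 2 < p) (h3 : p < 3) (G : V2) :
    Integrable (flux p G) volume := by
  refine (V2.integrable_norm_rpow_mul G G (by linarith : 0 < p - 2) (by linarith)).mono'
    ((V2.aestronglyMeasurable_norm_rpow G _).smul (Lp.aestronglyMeasurable G))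
    (Eventually.of_forall fun x => ?_)
  rw [flux, norm_smul, Real.norm_of_nonneg (Real.rpow_nonneg (norm_nonneg _) _)]

theorem integral_norm_flux_sub_le {p : ℝ} (h2 : 2 < p) (h3 : p < 3) (G H : V2) :
    ∫ x, ‖flux p G x - flux p H x‖ ≤ (‖G‖ ^ (p - 2) + ‖H‖ ^ (p - 2)) * ‖G - H‖ := by
  have h0 : 0 < p - 2 := by linarith
  have h1 : p - 2 ≤ 1 := by linarith
  have iG := V2.integrable_norm_rpow_mul G (G - H) h0 h1
  have iH := V2.integrable_norm_rpow_mul H (G - H) h0 h1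
  rw [add_mul]
  refine le_trans ?_ (add_le_add (V2.integral_norm_rpow_mul_le G (G - H) h0 h1)
    (V2.integral_norm_rpow_mul_le H (G - H) h0 h1))
  rw [← integral_add iG iH]
  refine integral_mono_ae ((integrable_flux h2 h3 G).sub (integrable_flux h2 h3 H)).norm
    (iG.add iH) ?_
  filter_upwards [Lp.coeFn_sub G H] with x hx
  simp only [hx, Pi.sub_apply, ← add_mul]
  exact norm_rpow_smul_sub_le h0 h1 _ _

/-- The Fourier coefficients of `∇ · (|G|^(p-2) G)`. -/
def divFlux (p : ℝ) (G : T2 → E2) (k : Fin 2 → ℤ) : ℂ :=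
  ∑ j, dsym k j * fourierCoeffR (fun x => flux p G x j) k

theorem divFlux_congr_ae (p : ℝ) {G H : T2 → E2} (h : G =ᵐ[volume] H) (k : Fin 2 → ℤ) :
    divFlux p G k = divFlux p H k := by
  unfold divFlux
  refine Finset.sum_congr rfl fun j _ => ?_
  congr 1
  refine fourierCoeffR_congr_ae ?_ k
  filter_upwards [flux_congr_ae p h] with x hx
  rw [hx]

theorem divFlux_neg_freq (p : ℝ) (G : T2 → E2) (k : Fin 2 → ℤ) :
    divFlux p G (-k) = (starRingEnd ℂ) (divFlux p G k) := by
  simp [divFlux, dsym_neg, fourierCoeffR_neg_freq]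

/-- Coefficients are bounded by the `L¹` norm, so the `L¹` Lipschitz bound on the flux suffices.
Each of the two components contributes `2π|k|`, hence the factor `4π`. -/
theorem norm_divFlux_sub_le {p : ℝ} (h2 : 2 < p) (h3 : p < 3) (G H : V2) (k : Fin 2 → ℤ) :
    ‖divFlux p G k - divFlux p H k‖ ≤
      4 * Real.pi * √(normSq k) * ((‖G‖ ^ (p - 2) + ‖H‖ ^ (p - 2)) * ‖G - H‖) := by
  have hG := integrable_flux h2 h3 G
  have hH := integrable_flux h2 h3 H
  have hi : Integrable (fun x => ‖flux p G x - flux p H x‖) volume := (hG.sub hH).norm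
  have key : ∀ j, ‖dsym k j * fourierCoeffR (fun x => flux p G x j) k -
      dsym k j * fourierCoeffR (fun x => flux p H x j) k‖ ≤
      2 * Real.pi * √(normSq k) * ∫ x, ‖flux p G x - flux p H x‖ := by
    intro j
    rw [← mul_sub, ← fourierCoeffR_sub (V2.integrable_coord hG j) (V2.integrable_coord hH j),
      norm_mul]
    refine mul_le_mul (norm_dsym_le k j) ((norm_fourierCoeffR_le _ k).trans ?_) (norm_nonneg _)
      (by positivity)
    refine integral_mono_of_nonneg (Eventually.of_forall fun x => abs_nonneg _) hi
      (Eventually.of_forall fun x => ?_)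
    exact PiLp.norm_apply_le (flux p G x - flux p H x) j
  rw [divFlux, divFlux, ← Finset.sum_sub_distrib]
  refine (norm_sum_le _ _).trans ((Finset.sum_le_sum fun j _ => key j).trans ?_)
  simp only [Finset.sum_const, Finset.card_univ, Fintype.card_fin, nsmul_eq_mul]
  calc _ = 4 * Real.pi * √(normSq k) * ∫ x, ‖flux p G x - flux p H x‖ := by push_cast; ring
    _ ≤ _ := by
      gcongr
      exact integral_norm_flux_sub_le h2 h3 G H

theorem divFlux_zero (p : ℝ) (k : Fin 2 → ℤ) : divFlux p (0 : V2) k = 0 := by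
  rw [divFlux_congr_ae p (Lp.coeFn_zero E2 2 volume)]
  simp [divFlux, flux, fourierCoeffR, UnitAddTorus.mFourierCoeff]

theorem norm_divFlux_le {p : ℝ} (h2 : 2 < p) (h3 : p < 3) (G : V2) (k : Fin 2 → ℤ) :
    ‖divFlux p G k‖ ≤ 4 * Real.pi * √(normSq k) * ‖G‖ ^ (p - 1) := by
  have := norm_divFlux_sub_le h2 h3 G 0 k
  rw [divFlux_zero, sub_zero, sub_zero, norm_zero, Real.zero_rpow (by linarith), add_zero] at this
  refine this.trans_eq ?_
  rw [show p - 1 = (p - 2) + 1 by ring,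
    Real.rpow_add_of_nonneg (norm_nonneg _) (by linarith) zero_le_one, Real.rpow_one]

/-! ### Semigroup smoothing and the singular time integral. -/

theorem exp_neg_le_rpow_neg {x a : ℝ} (hx : 0 < x) (ha0 : 0 ≤ a) (ha1 : a ≤ 1) :
    Real.exp (-x) ≤ x ^ (-a) := by
  rw [Real.exp_neg, Real.rpow_neg hx.le]
  refine inv_anti₀ (Real.rpow_pos_of_pos hx a) ?_
  calc x ^ a ≤ (x + 1) ^ a := Real.rpow_le_rpow hx.le (by linarith) ha0
    _ ≤ (x + 1) ^ (1 : ℝ) := Real.rpow_le_rpow_of_exponent_le (by linarith) ha1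
    _ = x + 1 := Real.rpow_one _
    _ ≤ Real.exp x := Real.add_one_le_exp x

/-- A majorant of `(t - s)^(-a) * s^(-b)` whose integral is explicit. -/
def singularMajorant (a b t s : ℝ) : ℝ :=
  (t / 2) ^ (-b) * (t - s) ^ (-a) + (t / 2) ^ (-a) * s ^ (-b)

/-- At most one of the two factors is singular on each half of `(0, t)`; the other is bounded by its
value at `t / 2`. This replaces the exact Beta integral. -/
theorem rpow_mul_rpow_le_singularMajorant {a b t s : ℝ} (ha : 0 ≤ a) (hb : 0 ≤ b)
    (hs : s ∈ Ioo 0 t) : (t - s) ^ (-a) * s ^ (-b) ≤ singularMajorant a b t s := by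
  obtain ⟨h0, h1⟩ := hs
  have hts : 0 < t - s := sub_pos.2 h1
  have ht : 0 < t / 2 := by linarith
  unfold singularMajorant
  have p1 : 0 < (t - s) ^ (-a) := Real.rpow_pos_of_pos hts _
  have p2 : 0 < s ^ (-b) := Real.rpow_pos_of_pos h0 _
  have p3 : 0 < (t / 2) ^ (-a) := Real.rpow_pos_of_pos ht _
  have p4 : 0 < (t / 2) ^ (-b) := Real.rpow_pos_of_pos ht _
  rcases le_total (t / 2) s with h | h
  · have : s ^ (-b) ≤ (t / 2) ^ (-b) := Real.rpow_le_rpow_of_nonpos ht h (by linarith)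
    nlinarith [mul_pos p3 p2, mul_le_mul_of_nonneg_left this p1.le]
  · have : (t - s) ^ (-a) ≤ (t / 2) ^ (-a) :=
      Real.rpow_le_rpow_of_nonpos ht (by linarith) (by linarith)
    nlinarith [mul_pos p4 p1, mul_le_mul_of_nonneg_right this p2.le]

theorem intervalIntegrable_singularMajorant {a b : ℝ} (ha : a < 1) (hb : b < 1) (t : ℝ) :
    IntervalIntegrable (singularMajorant a b t) volume 0 t := by
  have h1 : IntervalIntegrable (fun s : ℝ => (t - s) ^ (-a)) volume 0 t := by
    have := (intervalIntegral.intervalIntegrable_rpow' (a := 0) (b := t)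
      (by linarith : -1 < -a)).comp_sub_left t
    simpa using this.symm
  exact (h1.const_mul _).add
    ((intervalIntegral.intervalIntegrable_rpow' (by linarith : -1 < -b)).const_mul _)

/-- The constant in the integral of `singularMajorant`. -/
def singularConst (a b : ℝ) : ℝ := 2 ^ b / (1 - a) + 2 ^ a / (1 - b)

theorem singularConst_pos {a b : ℝ} (ha : a < 1) (hb : b < 1) : 0 < singularConst a b := by
  have h1 : 0 < 1 - a := by linarith
  have h2 : 0 < 1 - b := by linarith
  unfold singularConst
  positivity

theorem integral_singularMajorant {a b t : ℝ} (ha : a < 1) (hb : b < 1) (ht : 0 < t) :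
    ∫ s in (0 : ℝ)..t, singularMajorant a b t s = singularConst a b * t ^ (1 - a - b) := by
  have h1 : IntervalIntegrable (fun s : ℝ => (t - s) ^ (-a)) volume 0 t := by
    have := (intervalIntegral.intervalIntegrable_rpow' (a := 0) (b := t)
      (by linarith : -1 < -a)).comp_sub_left t
    simpa using this.symm
  have h2 : IntervalIntegrable (fun s : ℝ => s ^ (-b)) volume 0 t :=
    intervalIntegral.intervalIntegrable_rpow' (by linarith : -1 < -b)
  unfold singularMajorant singularConst
  rw [intervalIntegral.integral_add (h1.const_mul _) (h2.const_mul _),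
    intervalIntegral.integral_const_mul, intervalIntegral.integral_const_mul,
    intervalIntegral.integral_comp_sub_left (fun s => s ^ (-a)),
    integral_rpow (Or.inl (by linarith)), integral_rpow (Or.inl (by linarith)), sub_self, sub_zero,
    Real.zero_rpow (by linarith), Real.zero_rpow (by linarith), sub_zero, sub_zero,
    Real.div_rpow ht.le zero_le_two, Real.div_rpow ht.le zero_le_two,
    Real.rpow_neg zero_le_two, Real.rpow_neg zero_le_two, add_mul,
    show -a + 1 = 1 - a by ring, show -b + 1 = 1 - b by ring]
  have e1 : t ^ (1 - a - b) = t ^ (-b) * t ^ (1 - a) := by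
    rw [← Real.rpow_add ht]; congr 1; ring
  have e2 : t ^ (1 - a - b) = t ^ (-a) * t ^ (1 - b) := by
    rw [← Real.rpow_add ht]; congr 1; ring
  congr 1
  · rw [e1]; simp only [div_eq_mul_inv, inv_inv]; ring
  · rw [e2]; simp only [div_eq_mul_inv, inv_inv]; ring

/-- The multiplier `exp(-κ τ |k|⁴)`. -/
def heat (κ τ : ℝ) (k : Fin 2 → ℤ) : ℝ := Real.exp (-(κ * τ * normPowFour k))

theorem heat_pos (κ τ : ℝ) (k : Fin 2 → ℤ) : 0 < heat κ τ k := Real.exp_pos _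

theorem heat_zero (κ : ℝ) (k : Fin 2 → ℤ) : heat κ 0 k = 1 := by simp [heat]

theorem heat_add (κ σ τ : ℝ) (k : Fin 2 → ℤ) : heat κ (σ + τ) k = heat κ σ k * heat κ τ k := by
  unfold heat
  rw [← Real.exp_add]
  congr 1
  ring

theorem heat_neg_freq (κ τ : ℝ) (k : Fin 2 → ℤ) : heat κ τ (-k) = heat κ τ k := by
  simp [heat, normPowFour]

theorem heat_le_one {κ τ : ℝ} (hκ : 0 < κ) (hτ : 0 ≤ τ) (k : Fin 2 → ℤ) : heat κ τ k ≤ 1 := by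
  unfold heat
  rw [Real.exp_le_one_iff, neg_nonpos, normPowFour_eq]
  positivity

theorem continuous_heat (κ : ℝ) (k : Fin 2 → ℤ) : Continuous fun τ => heat κ τ k := by
  unfold heat
  fun_prop

theorem heat_le {κ τ a : ℝ} (hκ : 0 < κ) (hτ : 0 < τ) (ha0 : 0 ≤ a) (ha1 : a ≤ 1)
    {k : Fin 2 → ℤ} (hk : k ≠ 0) :
    heat κ τ k ≤ κ ^ (-a) * τ ^ (-a) * normSq k ^ (-(2 * a)) := by
  have hN : 0 < normSq k := zero_lt_one.trans_le (one_le_normSq hk)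
  unfold heat
  rw [normPowFour_eq]
  refine (exp_neg_le_rpow_neg (by positivity) ha0 ha1).trans_eq ?_
  rw [Real.mul_rpow (by positivity) (by positivity), Real.mul_rpow hκ.le hτ.le,
    ← Real.rpow_natCast, ← Real.rpow_mul hN.le]
  congr 2
  push_cast
  ring

/-- The weight `|k|^(1-4a)` by which the Duhamel term is bounded. -/
def weight (a : ℝ) (k : Fin 2 → ℤ) : ℝ := normSq k ^ (1 / 2 - 2 * a)

theorem weight_nonneg (a : ℝ) (k : Fin 2 → ℤ) : 0 ≤ weight a k :=
  Real.rpow_nonneg (normSq_nonneg k) _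

/-- The constant of the Duhamel estimate. -/
def duhamelConst (κ a b : ℝ) : ℝ := κ ^ (-a) * singularConst a b

theorem duhamelConst_pos {κ a b : ℝ} (hκ : 0 < κ) (ha : a < 1) (hb : b < 1) :
    0 < duhamelConst κ a b := by
  unfold duhamelConst
  have := singularConst_pos ha hb
  positivity

/-- The exponent `a` is left free: it trades decay in `k` against singularity at `s = t`. One value
serves the `L²` continuity at time zero, another the gradient. -/
theorem norm_heat_mul_le {κ a b A t s : ℝ} (hκ : 0 < κ) (ha0 : 0 ≤ a) (ha1 : a ≤ 1) (hb : 0 ≤ b)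
    (hA : 0 ≤ A) (hs : s ∈ Ioo 0 t) (k : Fin 2 → ℤ) {z : ℂ}
    (hz : ‖z‖ ≤ A * √(normSq k) * s ^ (-b)) :
    ‖(heat κ (t - s) k : ℂ) * z‖ ≤ A * κ ^ (-a) * weight a k * singularMajorant a b t s := by
  have hts : 0 < t - s := sub_pos.2 hs.2
  have hmaj := rpow_mul_rpow_le_singularMajorant ha0 hb hs
  have hmaj0 : 0 ≤ (t - s) ^ (-a) * s ^ (-b) :=
    mul_nonneg (Real.rpow_nonneg hts.le _) (Real.rpow_nonneg hs.1.le _)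
  have hκ' : 0 < κ ^ (-a) := Real.rpow_pos_of_pos hκ _
  have hw := weight_nonneg a k
  -- The semigroup does not decay at frequency zero, but there the factor `√(normSq k)` in the
  -- hypothesis forces `z = 0`.
  by_cases hk : k = 0
  · have hN : normSq k = 0 := normSq_eq_zero.2 hk
    have : z = 0 := by
      rw [hN] at hz
      simpa using hz
    rw [this, mul_zero, norm_zero]
    have := hmaj0.trans hmaj
    positivity
  · have hN : 0 < normSq k := zero_lt_one.trans_le (one_le_normSq hk)
    rw [norm_mul, Complex.norm_real, Real.norm_of_nonneg (heat_pos _ _ _).le]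
    have hh := heat_le hκ hts ha0 ha1 hk
    have e : normSq k ^ (-(2 * a)) * √(normSq k) = weight a k := by
      rw [Real.sqrt_eq_rpow, ← Real.rpow_add hN, weight]
      congr 1
      ring
    calc heat κ (t - s) k * ‖z‖ ≤
        (κ ^ (-a) * (t - s) ^ (-a) * normSq k ^ (-(2 * a))) * (A * √(normSq k) * s ^ (-b)) :=
          mul_le_mul hh hz (norm_nonneg _) ((heat_pos κ (t - s) k).le.trans hh)
      _ = A * κ ^ (-a) * (normSq k ^ (-(2 * a)) * √(normSq k)) *
          ((t - s) ^ (-a) * s ^ (-b)) := by ring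
      _ ≤ _ := by
        rw [e]
        gcongr

/-- The Duhamel integral in frequency `k`. -/
def duhamel (κ : ℝ) (φ : ℝ → (Fin 2 → ℤ) → ℂ) (t : ℝ) (k : Fin 2 → ℤ) : ℂ :=
  ∫ s in (0 : ℝ)..t, (heat κ (t - s) k : ℂ) * φ s k

theorem norm_duhamel_le {κ a b A t : ℝ} (hκ : 0 < κ) (ha0 : 0 ≤ a) (ha1 : a < 1) (hb0 : 0 ≤ b)
    (hb1 : b < 1) (hA : 0 ≤ A) (ht : 0 < t) {k : Fin 2 → ℤ} {φ : ℝ → (Fin 2 → ℤ) → ℂ}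
    (hφ : ∀ s ∈ Ioo 0 t, ‖φ s k‖ ≤ A * √(normSq k) * s ^ (-b)) :
    ‖duhamel κ φ t k‖ ≤ A * duhamelConst κ a b * t ^ (1 - a - b) * weight a k := by
  refine (intervalIntegral.norm_integral_le_of_norm_le ht.le ?_
    ((intervalIntegrable_singularMajorant ha1 hb1 t).const_mul
      (A * κ ^ (-a) * weight a k))).trans_eq ?_
  · have : ∀ᵐ s : ℝ, s ≠ t := by simp [ae_iff]
    filter_upwards [this] with s hst hs
    exact norm_heat_mul_le hκ ha0 ha1.le hb0 hA ⟨hs.1, lt_of_le_of_ne hs.2 hst⟩ k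
      (hφ s ⟨hs.1, lt_of_le_of_ne hs.2 hst⟩)
  · rw [intervalIntegral.integral_const_mul, integral_singularMajorant ha1 hb1 ht, duhamelConst]
    ring

/-! ### Lattice sums and gradient bounds. -/

theorem norm_sq_le_normSq (k : Fin 2 → ℤ) : ‖k‖ ^ 2 ≤ normSq k := by
  have h : ‖k‖ ≤ √(normSq k) := by
    rw [pi_norm_le_iff_of_nonneg (Real.sqrt_nonneg _)]
    intro j
    rw [Int.norm_eq_abs, ← Real.sqrt_sq_eq_abs]
    exact Real.sqrt_le_sqrt (Finset.single_le_sum (f := fun j => (k j : ℝ) ^ 2)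
      (fun _ _ => sq_nonneg _) (Finset.mem_univ j))
  calc ‖k‖ ^ 2 ≤ √(normSq k) ^ 2 := pow_le_pow_left₀ (norm_nonneg _) h 2
    _ = normSq k := Real.sq_sqrt (normSq_nonneg k)

/-- The Euclidean norm dominates the sup norm of `k`, and in dimension two the sum of `‖k‖^(-2r)`
converges for `2r > 2`. At `k = 0` both terms are `0`, as real powers of zero with nonzero exponent.
-/
theorem summable_normSq_rpow {r : ℝ} (hr : 1 < r) :
    Summable fun k : Fin 2 → ℤ => normSq k ^ (-r) := by
  refine (EisensteinSeries.summable_one_div_norm_rpow (by linarith : 2 < 2 * r)).of_nonneg_of_le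
    (fun k => Real.rpow_nonneg (normSq_nonneg k) _) fun k => ?_
  by_cases hk : k = 0
  · rw [normSq_eq_zero.2 hk, hk, norm_zero, Real.zero_rpow (by linarith),
      Real.zero_rpow (by linarith)]
  · have h0 : 0 < ‖k‖ := norm_pos_iff.2 hk
    calc normSq k ^ (-r) ≤ (‖k‖ ^ 2) ^ (-r) :=
          Real.rpow_le_rpow_of_nonpos (by positivity) (norm_sq_le_normSq k) (by linarith)
      _ = ‖k‖ ^ (-(2 * r)) := by
          rw [← Real.rpow_natCast, ← Real.rpow_mul h0.le]
          congr 1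
          push_cast
          ring

theorem summable_weight_sq {a : ℝ} (ha : 1 / 2 < a) :
    Summable fun k : Fin 2 → ℤ => weight a k ^ 2 := by
  refine (summable_normSq_rpow (by linarith : 1 < 4 * a - 1)).congr fun k => ?_
  unfold weight
  rw [← Real.rpow_natCast, ← Real.rpow_mul (normSq_nonneg k)]
  congr 1
  push_cast
  ring

/-- The terms are `|k|^(4-8a)`, and `8a - 4 > 2` is exactly `a > 3/4`. Without the gradient factor
the terms are `|k|^(2-8a)`, and `a > 1/2` is enough. -/
theorem summable_normSq_mul_weight_sq {a : ℝ} (ha : 3 / 4 < a) :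
    Summable fun k : Fin 2 → ℤ => normSq k * weight a k ^ 2 := by
  refine (summable_normSq_rpow (by linarith : 1 < 4 * a - 2)).congr fun k => ?_
  by_cases hk : k = 0
  · rw [normSq_eq_zero.2 hk, zero_mul, Real.zero_rpow (by linarith)]
  · have hN : 0 < normSq k := zero_lt_one.trans_le (one_le_normSq hk)
    unfold weight
    nth_rewrite 2 [← Real.rpow_one (normSq k)]
    rw [← Real.rpow_natCast, ← Real.rpow_mul hN.le, ← Real.rpow_add hN]
    congr 1
    push_cast
    ring

/-- The constant of the gradient estimate. -/
def gradConst (a : ℝ) : ℝ := 2 * Real.pi * √(∑' k : Fin 2 → ℤ, normSq k * weight a k ^ 2)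

theorem gradConst_nonneg (a : ℝ) : 0 ≤ gradConst a := by
  unfold gradConst
  have := Real.pi_pos
  positivity

theorem IsWeakGradient.norm_le_of_weight {a B : ℝ} (ha : 3 / 4 < a) (hB : 0 ≤ B) {f : T2 → ℝ} {G : V2}
    (h : IsWeakGradient f G) (hf : ∀ k, ‖fourierCoeffR f k‖ ≤ B * weight a k) :
    ‖G‖ ≤ B * gradConst a := by
  have hS : 0 ≤ ∑' k : Fin 2 → ℤ, normSq k * weight a k ^ 2 :=
    tsum_nonneg fun k => mul_nonneg (normSq_nonneg k) (sq_nonneg _)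
  have hc := gradConst_nonneg a
  refine le_of_sq_le_sq ?_ (by positivity)
  have hs := (summable_normSq_mul_weight_sq ha).hasSum.mul_left ((2 * Real.pi) ^ 2 * B ^ 2)
  refine (hasSum_le (fun k => ?_) h.hasSum_norm_sq hs).trans_eq ?_
  · have h1 : ‖fourierCoeffR f k‖ ^ 2 ≤ (B * weight a k) ^ 2 :=
      pow_le_pow_left₀ (norm_nonneg _) (hf k) 2
    have h2 := normSq_nonneg k
    calc _ ≤ (2 * Real.pi) ^ 2 * normSq k * (B * weight a k) ^ 2 := by gcongr
      _ = _ := by ring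
  · rw [gradConst, mul_pow B, mul_pow (2 * Real.pi) (√_), Real.sq_sqrt hS]
    ring

/-- The exponent `a = 1/4` gains exactly one power of `|k|`, which cancels the gradient and leaves
`t^(-1/4)`. This is the source of the weight in the solution space. -/
theorem normSq_mul_heat_sq_le {κ t : ℝ} (hκ : 0 < κ) (ht : 0 < t) (k : Fin 2 → ℤ) :
    normSq k * heat κ t k ^ 2 ≤ (κ ^ (-(1 / 4 : ℝ)) * t ^ (-(1 / 4 : ℝ))) ^ 2 := by
  by_cases hk : k = 0
  · rw [normSq_eq_zero.2 hk, zero_mul]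
    positivity
  · have hN : 0 < normSq k := zero_lt_one.trans_le (one_le_normSq hk)
    have h1 := heat_le hκ ht (a := 1 / 4) (by norm_num) (by norm_num) hk
    calc normSq k * heat κ t k ^ 2 ≤ normSq k * (κ ^ (-(1 / 4 : ℝ)) * t ^ (-(1 / 4 : ℝ)) *
          normSq k ^ (-(2 * (1 / 4) : ℝ))) ^ 2 :=
          mul_le_mul_of_nonneg_left (pow_le_pow_left₀ (heat_pos _ _ _).le h1 2) hN.le
      _ = (κ ^ (-(1 / 4 : ℝ)) * t ^ (-(1 / 4 : ℝ))) ^ 2 *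
          (normSq k * (normSq k ^ (-(2 * (1 / 4) : ℝ))) ^ 2) := by ring
      _ = _ := by
        have : (normSq k ^ (-(2 * (1 / 4) : ℝ))) ^ 2 = (normSq k)⁻¹ := by
          rw [← Real.rpow_natCast, ← Real.rpow_mul hN.le, ← Real.rpow_neg_one]
          norm_num
        rw [this, mul_inv_cancel₀ hN.ne', mul_one]

/-! ### Continuity in time from continuity of the coefficients. -/

theorem fourierCoeffR_L2_sub (f g : L2) (k : Fin 2 → ℤ) :
    fourierCoeffR (f - g : L2) k = fourierCoeffR f k - fourierCoeffR g k := by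
  rw [← fourierCoeffR_sub (L2.integrable f) (L2.integrable g)]
  exact fourierCoeffR_congr_ae (Lp.coeFn_sub f g) k

theorem continuousOn_of_norm_sub_sq {E : Type*} [NormedAddCommGroup E] {u : ℝ → E} {S : Set ℝ}
    {F : ℝ → ℝ → ℝ} (hF : ∀ t₀ ∈ S, ContinuousOn (F t₀) S)
    (h : ∀ t₀ ∈ S, ∀ t ∈ S, ‖u t - u t₀‖ ^ 2 = F t₀ t) : ContinuousOn u S := by
  intro t₀ ht₀
  unfold ContinuousWithinAt
  rw [tendsto_iff_norm_sub_tendsto_zero]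
  have h0 : F t₀ t₀ = 0 := by rw [← h t₀ ht₀ t₀ ht₀]; simp
  have h1 : Tendsto (F t₀) (𝓝[S] t₀) (𝓝 0) := by
    have := hF t₀ ht₀ t₀ ht₀
    rwa [ContinuousWithinAt, h0] at this
  have h2 := (Real.continuous_sqrt.tendsto 0).comp h1
  rw [Real.sqrt_zero] at h2
  refine h2.congr' ?_
  filter_upwards [self_mem_nhdsWithin] with t ht
  rw [Function.comp_apply, ← h t₀ ht₀ t ht, Real.sqrt_sq (norm_nonneg _)]

theorem norm_sub_sq_le_of_le {z w : ℂ} {B : ℝ} (hz : ‖z‖ ≤ B) (hw : ‖w‖ ≤ B) :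
    ‖z - w‖ ^ 2 ≤ 4 * B ^ 2 := by
  have : ‖z - w‖ ≤ 2 * B := (norm_sub_le z w).trans (by linarith)
  calc ‖z - w‖ ^ 2 ≤ (2 * B) ^ 2 := pow_le_pow_left₀ (norm_nonneg _) this 2
    _ = 4 * B ^ 2 := by ring

/-- By Parseval `‖u(t) - u(t₀)‖²` is a series of continuous functions of `t`, dominated uniformly by
`4 B(k)²`. -/
theorem continuousOn_L2_of_coeff {u : ℝ → L2} {S : Set ℝ} {B : (Fin 2 → ℤ) → ℝ}
    (hc : ∀ k, ContinuousOn (fun t => fourierCoeffR (u t) k) S)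
    (hB : ∀ t ∈ S, ∀ k, ‖fourierCoeffR (u t) k‖ ≤ B k) (hs : Summable fun k => B k ^ 2) :
    ContinuousOn u S := by
  refine continuousOn_of_norm_sub_sq
    (F := fun t₀ t => ∑' k, ‖fourierCoeffR (u t) k - fourierCoeffR (u t₀) k‖ ^ 2)
    (fun t₀ ht₀ => ?_) fun t₀ _ t _ => ?_
  · refine continuousOn_tsum (fun k => (((hc k).sub continuousOn_const).norm.pow 2))
      (hs.mul_left 4) fun k t ht => ?_
    rw [Real.norm_of_nonneg (by positivity)]
    exact norm_sub_sq_le_of_le (hB t ht k) (hB t₀ ht₀ k)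
  · have := (hasSum_sq_fourierCoeffR (u t - u t₀)).tsum_eq
    rw [integral_sq_eq_norm_sq] at this
    rw [← this]
    simp_rw [fourierCoeffR_L2_sub]

theorem continuousOn_V2_of_coeff {u : ℝ → L2} {G : ℝ → V2} {S : Set ℝ} {B : (Fin 2 → ℤ) → ℝ}
    (hG : ∀ t ∈ S, IsWeakGradient (u t) (G t))
    (hc : ∀ k, ContinuousOn (fun t => fourierCoeffR (u t) k) S)
    (hB : ∀ t ∈ S, ∀ k, ‖fourierCoeffR (u t) k‖ ≤ B k)
    (hs : Summable fun k => normSq k * B k ^ 2) : ContinuousOn G S := by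
  refine continuousOn_of_norm_sub_sq
    (F := fun t₀ t => ∑' k, (2 * Real.pi) ^ 2 * normSq k *
      ‖fourierCoeffR (u t) k - fourierCoeffR (u t₀) k‖ ^ 2)
    (fun t₀ ht₀ => ?_) fun t₀ ht₀ t ht => ?_
  · refine continuousOn_tsum
      (fun k => (continuousOn_const.mul (((hc k).sub continuousOn_const).norm.pow 2)))
      (hs.mul_left ((2 * Real.pi) ^ 2 * 4)) fun k t ht => ?_
    have hN := normSq_nonneg k
    rw [Real.norm_of_nonneg (by positivity)]
    calc _ ≤ (2 * Real.pi) ^ 2 * normSq k * (4 * B k ^ 2) := by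
          gcongr
          exact norm_sub_sq_le_of_le (hB t ht k) (hB t₀ ht₀ k)
      _ = _ := by ring
  · have := ((hG t ht).sub (hG t₀ ht₀)).hasSum_norm_sq.tsum_eq
    rw [← this]
    simp_rw [fourierCoeffR_L2_sub]

theorem continuous_divFlux {p : ℝ} (h2 : 2 < p) (h3 : p < 3) (k : Fin 2 → ℤ) :
    Continuous fun G : V2 => divFlux p G k := by
  rw [continuous_iff_continuousAt]
  intro H
  unfold ContinuousAt
  rw [tendsto_iff_norm_sub_tendsto_zero]
  refine squeeze_zero (fun _ => norm_nonneg _) (fun G => norm_divFlux_sub_le h2 h3 G H k) ?_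
  have hα : 0 ≤ p - 2 := by linarith
  have hc : Continuous fun G : V2 =>
      4 * Real.pi * √(normSq k) * ((‖G‖ ^ (p - 2) + ‖H‖ ^ (p - 2)) * ‖G - H‖) :=
    continuous_const.mul ((((continuous_norm.rpow_const fun _ => Or.inr hα)).add
      continuous_const).mul (continuous_id.sub continuous_const).norm)
  have := hc.tendsto H
  simpa using this

/-! ### The solution operator on gradient fields and its estimates. -/

/-- The time exponent in the smoothing estimate for gradients. -/
def gradExp (p : ℝ) : ℝ := (9 - p) / 8

/-- A family of vector fields `P(t)`, `0 < t ≤ T`, with `‖P(t)‖ ≤ M t^(-1/4)` and integrable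
Fourier coefficients of `∇ · (|P|^(p-2) P)`. -/
structure IsAdmissible (p T M : ℝ) (P : ℝ → V2) : Prop where
  bound : ∀ t ∈ Ioc 0 T, ‖P t‖ ≤ M * t ^ (-(1 / 4) : ℝ)
  integrable : ∀ k, IntervalIntegrable (fun s => divFlux p (P s) k) volume 0 T

/-- `u = e^{-t𝓛} u₀ - ∫₀ᵗ ∇·e^{-(t-s)𝓛}(|P|^(p-2) P) ds` in terms of Fourier coefficients, and
`G = ∇u`. -/
structure IsDuhamelStep (κ p T : ℝ) (u₀ : L2) (P : ℝ → V2) (u : ℝ → L2) (G : ℝ → V2) : Prop where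
  grad : ∀ t ∈ Ioc 0 T, IsWeakGradient (u t) (G t)
  eq : ∀ t ∈ Icc 0 T, ∀ k, fourierCoeffR (u t) k =
    heat κ t k * fourierCoeffR u₀ k - duhamel κ (fun s => divFlux p (P s)) t k

theorem rpow_mul_rpow_neg_quarter {M t : ℝ} (hM : 0 ≤ M) (ht : 0 < t) (r : ℝ) :
    (M * t ^ (-(1 / 4) : ℝ)) ^ r = M ^ r * t ^ (-(r / 4)) := by
  rw [Real.mul_rpow hM (Real.rpow_nonneg ht.le _), ← Real.rpow_mul ht.le]
  congr 2
  ring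

theorem norm_divFlux_le_of_norm_le {p M s : ℝ} {G : V2} (h2 : 2 < p) (h3 : p < 3) (hM : 0 ≤ M)
    (hs : 0 < s) (hG : ‖G‖ ≤ M * s ^ (-(1 / 4) : ℝ)) (k : Fin 2 → ℤ) :
    ‖divFlux p G k‖ ≤ (4 * Real.pi * M ^ (p - 1)) * √(normSq k) * s ^ (-((p - 1) / 4)) := by
  refine (norm_divFlux_le h2 h3 G k).trans ?_
  have := Real.rpow_le_rpow (norm_nonneg _) hG (by linarith : 0 ≤ p - 1)
  rw [rpow_mul_rpow_neg_quarter hM hs] at this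
  have hpi := Real.pi_pos
  calc _ ≤ 4 * Real.pi * √(normSq k) * (M ^ (p - 1) * s ^ (-((p - 1) / 4))) := by gcongr
    _ = _ := by ring

theorem IsAdmissible.mono {p T T' M : ℝ} {P : ℝ → V2} (h : IsAdmissible p T M P) (h0 : 0 ≤ T')
    (hT : T' ≤ T) : IsAdmissible p T' M P where
  bound t ht := h.bound t ⟨ht.1, ht.2.trans hT⟩
  integrable k := (h.integrable k).mono_set (by
    rw [uIcc_of_le h0, uIcc_of_le (h0.trans hT)]
    exact Icc_subset_Icc_right hT)

/-- At a single frequency the backward multiplier `heat κ (-s) k` is harmless, so `t` can be taken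
out of the integrand; continuity in `t` is then that of a primitive. -/
theorem duhamel_eq (κ : ℝ) (φ : ℝ → (Fin 2 → ℤ) → ℂ) (t : ℝ) (k : Fin 2 → ℤ) :
    duhamel κ φ t k = heat κ t k * ∫ s in (0 : ℝ)..t, (heat κ (-s) k : ℂ) * φ s k := by
  rw [duhamel, ← intervalIntegral.integral_const_mul]
  refine intervalIntegral.integral_congr fun s _ => ?_
  simp only [sub_eq_add_neg t s, heat_add]
  push_cast
  ring

theorem intervalIntegrable_heat_mul {κ a b : ℝ} {f : ℝ → ℂ} (hf : IntervalIntegrable f volume a b)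
    {τ : ℝ → ℝ} (hτ : Continuous τ) (k : Fin 2 → ℤ) :
    IntervalIntegrable (fun s => (heat κ (τ s) k : ℂ) * f s) volume a b :=
  hf.continuousOn_mul
    (Complex.continuous_ofReal.comp ((continuous_heat κ k).comp hτ)).continuousOn

theorem continuousOn_duhamel {κ T : ℝ} (hT : 0 ≤ T) {φ : ℝ → (Fin 2 → ℤ) → ℂ} {k : Fin 2 → ℤ}
    (hφ : IntervalIntegrable (fun s => φ s k) volume 0 T) :
    ContinuousOn (fun t => duhamel κ φ t k) (Icc 0 T) := by
  have := intervalIntegral.continuousOn_primitive_interval'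
    (intervalIntegrable_heat_mul (κ := κ) hφ continuous_neg k) left_mem_uIcc
  rw [uIcc_of_le hT] at this
  simp_rw [duhamel_eq]
  exact (Complex.continuous_ofReal.comp (continuous_heat κ k)).continuousOn.mul this

theorem duhamel_sub {κ t : ℝ} {φ ψ : ℝ → (Fin 2 → ℤ) → ℂ} {k : Fin 2 → ℤ}
    (hφ : IntervalIntegrable (fun s => φ s k) volume 0 t)
    (hψ : IntervalIntegrable (fun s => ψ s k) volume 0 t) :
    duhamel κ (fun s k => φ s k - ψ s k) t k = duhamel κ φ t k - duhamel κ ψ t k := by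
  have hτ : Continuous fun s : ℝ => t - s := continuous_const.sub continuous_id
  unfold duhamel
  rw [← intervalIntegral.integral_sub (intervalIntegrable_heat_mul hφ hτ k)
    (intervalIntegrable_heat_mul hψ hτ k)]
  simp_rw [mul_sub]

theorem duhamel_neg_freq {κ t : ℝ} {φ : ℝ → (Fin 2 → ℤ) → ℂ} {k : Fin 2 → ℤ}
    (hφ : ∀ s, φ s (-k) = (starRingEnd ℂ) (φ s k)) :
    duhamel κ φ t (-k) = (starRingEnd ℂ) (duhamel κ φ t k) := by
  unfold duhamel
  rw [← intervalIntegral.intervalIntegral_conj]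
  simp [hφ, heat_neg_freq]

section

variable {κ p T M : ℝ} {u₀ : L2} {P : ℝ → V2} {u : ℝ → L2} {G : ℝ → V2}

theorem IsDuhamelStep.continuousOn_coeff (hT : 0 ≤ T) (hP : IsAdmissible p T M P)
    (h : IsDuhamelStep κ p T u₀ P u G) (k : Fin 2 → ℤ) :
    ContinuousOn (fun t => fourierCoeffR (u t) k) (Icc 0 T) := by
  have hc : ContinuousOn (fun t => (heat κ t k : ℂ) * fourierCoeffR u₀ k -
      duhamel κ (fun s => divFlux p (P s)) t k) (Icc 0 T) :=
    ((Complex.continuous_ofReal.comp (continuous_heat κ k)).continuousOn.mul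
      continuousOn_const).sub (continuousOn_duhamel hT (hP.integrable k))
  exact hc.congr fun t ht => h.eq t ht k

theorem IsAdmissible.norm_duhamel_le (hκ : 0 < κ) (h2 : 2 < p) (h3 : p < 3) (hM : 0 ≤ M)
    (hP : IsAdmissible p T M P) {a : ℝ} (ha0 : 0 ≤ a) (ha1 : a < 1) {t : ℝ} (ht : t ∈ Ioc 0 T)
    (k : Fin 2 → ℤ) :
    ‖duhamel κ (fun s => divFlux p (P s)) t k‖ ≤ 4 * Real.pi * M ^ (p - 1) *
      duhamelConst κ a ((p - 1) / 4) * t ^ (1 - a - (p - 1) / 4) * weight a k := by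
  have hpi := Real.pi_pos
  exact ThinFilm.norm_duhamel_le hκ ha0 ha1 (by linarith) (by linarith) (by positivity) ht.1
    fun s hs => norm_divFlux_le_of_norm_le h2 h3 hM hs.1
      (hP.bound s ⟨hs.1, hs.2.le.trans ht.2⟩) k

theorem summable_add_sq {ι : Type*} {f g w : ι → ℝ} (hw : ∀ i, 0 ≤ w i)
    (hf : Summable fun i => w i * f i ^ 2)
    (hg : Summable fun i => w i * g i ^ 2) : Summable fun i => w i * (f i + g i) ^ 2 := by
  refine ((hf.add hg).mul_left 2).of_nonneg_of_le (fun i => mul_nonneg (hw i) (sq_nonneg _))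
    fun i => ?_
  nlinarith [mul_nonneg (hw i) (sq_nonneg (f i - g i))]

theorem IsDuhamelStep.continuousOn (hκ : 0 < κ) (h2 : 2 < p) (h3 : p < 3) (hM : 0 ≤ M)
    (hT : 0 ≤ T) (hP : IsAdmissible p T M P) (h : IsDuhamelStep κ p T u₀ P u G) :
    ContinuousOn u (Icc 0 T) := by
  -- The midpoint of the window `1/2 < a < (5-p)/4`. The lower bound makes `weight a` square
  -- summable; the upper one makes the power of `t` positive, so the bound is uniform down to `t =
  -- 0`.
  set a := (7 - p) / 8 with ha
  set C := 4 * Real.pi * M ^ (p - 1) * duhamelConst κ a ((p - 1) / 4) *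
    T ^ (1 - a - (p - 1) / 4) with hC
  have hpi := Real.pi_pos
  have hd := duhamelConst_pos hκ (by linarith : a < 1) (by linarith : (p - 1) / 4 < 1)
  refine continuousOn_L2_of_coeff (B := fun k => ‖fourierCoeffR u₀ k‖ + C * weight a k)
    (h.continuousOn_coeff hT hP) (fun t ht k => ?_) ?_
  · rw [h.eq t ht]
    have hw := weight_nonneg a k
    refine (norm_sub_le _ _).trans (add_le_add ?_ ?_)
    · rw [norm_mul, Complex.norm_real, Real.norm_of_nonneg (heat_pos _ _ _).le]
      exact mul_le_of_le_one_left (norm_nonneg _) (heat_le_one hκ ht.1 k)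
    · rcases ht.1.eq_or_lt with h0 | h0
      · rw [← h0, duhamel, intervalIntegral.integral_same, norm_zero]
        positivity
      · refine (hP.norm_duhamel_le hκ h2 h3 hM (by linarith : 0 ≤ a) (by linarith)
          ⟨h0, ht.2⟩ k).trans ?_
        rw [hC]
        have := Real.rpow_le_rpow ht.1 ht.2 (by linarith : 0 ≤ 1 - a - (p - 1) / 4)
        gcongr
  · have := summable_add_sq (w := fun _ => 1) (f := fun k => ‖fourierCoeffR u₀ k‖)
      (g := fun k => C * weight a k) (fun _ => zero_le_one)
      (by simpa using (hasSum_sq_fourierCoeffR u₀).summable)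
      (by simpa [mul_pow] using (summable_weight_sq (by linarith : 1 / 2 < a)).mul_left (C ^ 2))
    simpa using this

theorem summable_heat_coeff (hκ : 0 < κ) {τ : ℝ} (hτ : 0 < τ) (u₀ : L2) :
    Summable fun k => normSq k * (heat κ τ k * ‖fourierCoeffR u₀ k‖) ^ 2 := by
  refine ((hasSum_sq_fourierCoeffR u₀).summable.mul_left
    ((κ ^ (-(1 / 4 : ℝ)) * τ ^ (-(1 / 4 : ℝ))) ^ 2)).of_nonneg_of_le
    (fun k => mul_nonneg (normSq_nonneg k) (sq_nonneg _)) fun k => ?_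
  rw [mul_pow, ← mul_assoc]
  exact mul_le_mul_of_nonneg_right (normSq_mul_heat_sq_le hκ hτ k) (sq_nonneg _)

theorem IsDuhamelStep.continuousOn_grad (hκ : 0 < κ) (h2 : 2 < p) (h3 : p < 3) (hM : 0 ≤ M)
    (hT : 0 ≤ T) (hP : IsAdmissible p T M P) (h : IsDuhamelStep κ p T u₀ P u G) :
    ContinuousOn G (Ioc 0 T) := by
  have hpi := Real.pi_pos
  have ha1 : gradExp p < 1 := by unfold gradExp; linarith
  have ha0 : 0 ≤ gradExp p := by unfold gradExp; linarith
  have hd := duhamelConst_pos hκ ha1 (by linarith : (p - 1) / 4 < 1)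
  -- The gradient may blow up at time zero. On `[τ, T]` a summable majorant exists: the free part is
  -- dominated by its value at `τ`, and so is the negative power of `t` in the Duhamel bound.
  have key : ∀ τ, 0 < τ → ContinuousOn G (Icc τ T) := by
    intro τ hτ
    set C := 4 * Real.pi * M ^ (p - 1) * duhamelConst κ (gradExp p) ((p - 1) / 4) *
      τ ^ (1 - gradExp p - (p - 1) / 4) with hC
    have hsub : Icc τ T ⊆ Icc 0 T := Icc_subset_Icc_left hτ.le
    refine continuousOn_V2_of_coeff
      (B := fun k => heat κ τ k * ‖fourierCoeffR u₀ k‖ + C * weight (gradExp p) k)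
      (fun t ht => h.grad t ⟨hτ.trans_le ht.1, ht.2⟩)
      (fun k => (h.continuousOn_coeff hT hP k).mono hsub) (fun t ht k => ?_) ?_
    · rw [h.eq t (hsub ht)]
      have hw := weight_nonneg (gradExp p) k
      refine (norm_sub_le _ _).trans (add_le_add ?_ ?_)
      · rw [norm_mul, Complex.norm_real, Real.norm_of_nonneg (heat_pos _ _ _).le]
        refine mul_le_mul_of_nonneg_right ?_ (norm_nonneg _)
        rw [← add_sub_cancel τ t, heat_add]
        exact mul_le_of_le_one_right (heat_pos _ _ _).le
          (heat_le_one hκ (sub_nonneg.2 ht.1) k)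
      · refine (hP.norm_duhamel_le hκ h2 h3 hM ha0 ha1 ⟨hτ.trans_le ht.1, ht.2⟩ k).trans ?_
        rw [hC]
        have := Real.rpow_le_rpow_of_nonpos hτ ht.1
          (by unfold gradExp; linarith : 1 - gradExp p - (p - 1) / 4 ≤ 0)
        gcongr
    · refine summable_add_sq normSq_nonneg (summable_heat_coeff hκ hτ u₀) ?_
      refine ((summable_normSq_mul_weight_sq
        (by unfold gradExp; linarith : 3 / 4 < gradExp p)).mul_left (C ^ 2)).congr fun k => ?_
      ring
  intro t ht
  have hmem : Icc (t / 2) T ∈ 𝓝[Ioc 0 T] t := by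
    filter_upwards [self_mem_nhdsWithin,
      mem_nhdsWithin_of_mem_nhds (Ioi_mem_nhds (half_lt_self ht.1))] with s hs hs'
    exact ⟨le_of_lt hs', hs.2⟩
  exact (key (t / 2) (half_pos ht.1) t ⟨(half_lt_self ht.1).le, ht.2⟩).mono_of_mem_nhdsWithin hmem

/-- The constant in the gradient estimate of the free evolution. -/
def freeConst (κ : ℝ) : ℝ := 2 * Real.pi * κ ^ (-(1 / 4 : ℝ))

/-- The constant in the Lipschitz estimate for the gradient of the Duhamel term. -/
def stepConst (κ p : ℝ) : ℝ :=
  8 * Real.pi * duhamelConst κ (gradExp p) ((p - 1) / 4) * gradConst (gradExp p)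

theorem stepConst_nonneg (hκ : 0 < κ) (h2 : 2 < p) (h3 : p < 3) : 0 ≤ stepConst κ p := by
  have hpi := Real.pi_pos
  have hd := duhamelConst_pos hκ (by unfold gradExp; linarith : gradExp p < 1)
    (by linarith : (p - 1) / 4 < 1)
  have := gradConst_nonneg (gradExp p)
  unfold stepConst
  positivity

/-- The time integral returns the admissible rate `t^(-1/4)` times a positive power of `t`. This
surplus is the subcriticality and is where `p < 3` pays off. -/
theorem rpow_gradExp {t : ℝ} (ht : 0 < t) :
    t ^ (1 - gradExp p - (p - 1) / 4) = t ^ ((3 - p) / 8) * t ^ (-(1 / 4) : ℝ) := by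
  rw [← Real.rpow_add ht]
  congr 1
  unfold gradExp
  ring

theorem exists_free_evolution (hκ : 0 < κ) (u₀ : L2) {t : ℝ} (ht : 0 < t) :
    ∃ (f : L2) (G : V2), (∀ k, fourierCoeffR f k = heat κ t k * fourierCoeffR u₀ k) ∧
      IsWeakGradient f G ∧ ‖G‖ ≤ freeConst κ * ‖u₀‖ * t ^ (-(1 / 4) : ℝ) := by
  obtain ⟨f, hf⟩ := exists_L2_of_hermitian (c := fun k => heat κ t k * fourierCoeffR u₀ k) (by
    refine (hasSum_sq_fourierCoeffR u₀).summable.of_nonneg_of_le (fun k => sq_nonneg _) fun k => ?_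
    rw [norm_mul, Complex.norm_real, Real.norm_of_nonneg (heat_pos _ _ _).le]
    exact pow_le_pow_left₀ (mul_nonneg (heat_pos _ _ _).le (norm_nonneg _))
      (mul_le_of_le_one_left (norm_nonneg _) (heat_le_one hκ ht.le k)) 2) fun k => by
    rw [heat_neg_freq, fourierCoeffR_neg_freq, map_mul, Complex.conj_ofReal]
  have hnf : ∀ k, ‖fourierCoeffR f k‖ = heat κ t k * ‖fourierCoeffR u₀ k‖ := fun k => by
    rw [hf, norm_mul, Complex.norm_real, Real.norm_of_nonneg (heat_pos _ _ _).le]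
  obtain ⟨G, hG⟩ := exists_isWeakGradient (f := f) (by
    simp_rw [hnf]
    exact summable_heat_coeff hκ ht u₀)
  refine ⟨f, G, hf, hG, ?_⟩
  have hpi := Real.pi_pos
  unfold freeConst
  refine le_of_sq_le_sq ?_ (by positivity)
  have hs := (hasSum_sq_fourierCoeffR u₀).mul_left ((2 * Real.pi) ^ 2 *
    (κ ^ (-(1 / 4 : ℝ)) * t ^ (-(1 / 4 : ℝ))) ^ 2)
  refine (hasSum_le (fun k => ?_) hG.hasSum_norm_sq hs).trans_eq ?_
  · rw [hnf]
    calc _ = (2 * Real.pi) ^ 2 * (normSq k * heat κ t k ^ 2) * ‖fourierCoeffR u₀ k‖ ^ 2 := by ring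
      _ ≤ _ := by
        gcongr
        exact normSq_mul_heat_sq_le hκ ht k
  · rw [integral_sq_eq_norm_sq]
    ring

theorem exists_duhamelStep (hκ : 0 < κ) (h2 : 2 < p) (h3 : p < 3) (hM : 0 ≤ M) (hT : 0 ≤ T)
    (u₀ : L2) (hP : IsAdmissible p T M P) :
    ∃ (u : ℝ → L2) (G : ℝ → V2), IsDuhamelStep κ p T u₀ P u G ∧ ∀ t ∈ Ioc 0 T,
      ‖G t‖ ≤ (freeConst κ * ‖u₀‖ + stepConst κ p * M ^ (p - 1) * T ^ ((3 - p) / 8)) *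
        t ^ (-(1 / 4) : ℝ) := by
  have hpi := Real.pi_pos
  have ha1 : gradExp p < 1 := by unfold gradExp; linarith
  have ha0 : 0 ≤ gradExp p := by unfold gradExp; linarith
  have hd := duhamelConst_pos hκ ha1 (by linarith : (p - 1) / 4 < 1)
  have hg := gradConst_nonneg (gradExp p)
  have key : ∀ t, ∃ (f : L2) (G : V2), t ∈ Icc 0 T →
      (∀ k, fourierCoeffR f k =
        heat κ t k * fourierCoeffR u₀ k - duhamel κ (fun s => divFlux p (P s)) t k) ∧
      (t ∈ Ioc 0 T → IsWeakGradient f G ∧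
        ‖G‖ ≤ (freeConst κ * ‖u₀‖ + stepConst κ p * M ^ (p - 1) * T ^ ((3 - p) / 8)) *
          t ^ (-(1 / 4) : ℝ)) := by
    intro t
    by_cases ht : t ∈ Ioc 0 T
    · obtain ⟨f₁, G₁, hf₁, hG₁, hn₁⟩ := exists_free_evolution hκ u₀ ht.1
      set B := 4 * Real.pi * M ^ (p - 1) * duhamelConst κ (gradExp p) ((p - 1) / 4) *
        t ^ (1 - gradExp p - (p - 1) / 4) with hB
      have htp : 0 ≤ t ^ (1 - gradExp p - (p - 1) / 4) := Real.rpow_nonneg ht.1.le _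
      have hB0 : 0 ≤ B := by positivity
      have hb := fun k => hP.norm_duhamel_le hκ h2 h3 hM ha0 ha1 ht k
      obtain ⟨f₂, hf₂⟩ := exists_L2_of_hermitian
        (c := fun k => duhamel κ (fun s => divFlux p (P s)) t k) (by
        refine ((summable_weight_sq (by unfold gradExp; linarith : 1 / 2 < gradExp p)).mul_left
          (B ^ 2)).of_nonneg_of_le (fun k => sq_nonneg _) fun k => ?_
        rw [← mul_pow]
        exact pow_le_pow_left₀ (norm_nonneg _) (hb k) 2) fun k =>
          duhamel_neg_freq fun s => divFlux_neg_freq p (P s) k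
      obtain ⟨G₂, hG₂⟩ := exists_isWeakGradient (f := f₂) (by
        simp_rw [hf₂]
        refine ((summable_normSq_mul_weight_sq
          (by unfold gradExp; linarith : 3 / 4 < gradExp p)).mul_left (B ^ 2)).of_nonneg_of_le
          (fun k => mul_nonneg (normSq_nonneg k) (sq_nonneg _)) fun k => ?_
        rw [mul_left_comm, ← mul_pow]
        exact mul_le_mul_of_nonneg_left (pow_le_pow_left₀ (norm_nonneg _) (hb k) 2)
          (normSq_nonneg k))
      have hn₂ : ‖G₂‖ ≤ B * gradConst (gradExp p) :=
        hG₂.norm_le_of_weight (by unfold gradExp; linarith) hB0 fun k => by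
          rw [hf₂]; exact hb k
      refine ⟨f₁ - f₂, G₁ - G₂, fun _ => ⟨fun k => ?_, fun _ => ⟨hG₁.sub hG₂, ?_⟩⟩⟩
      · rw [fourierCoeffR_L2_sub, hf₁, hf₂]
      · refine (norm_sub_le _ _).trans ?_
        rw [add_mul]
        refine add_le_add hn₁ (hn₂.trans ?_)
        have hmono : t ^ ((3 - p) / 8) ≤ T ^ ((3 - p) / 8) :=
          Real.rpow_le_rpow ht.1.le ht.2 (by linarith)
        have h4 : 0 ≤ t ^ (-(1 / 4) : ℝ) := Real.rpow_nonneg ht.1.le _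
        have hMp : 0 ≤ M ^ (p - 1) := Real.rpow_nonneg hM _
        have ht8 : 0 ≤ t ^ ((3 - p) / 8) := Real.rpow_nonneg ht.1.le _
        -- The size estimate needs only `4π`; the larger `8π` in `stepConst` comes from the
        -- Lipschitz estimate, so that one constant serves both.
        have h48 : (4 : ℝ) ≤ 8 := by norm_num
        have hT8 : 0 ≤ T ^ ((3 - p) / 8) := Real.rpow_nonneg hT _
        rw [hB, rpow_gradExp ht.1]
        unfold stepConst
        calc _ = 4 * Real.pi * M ^ (p - 1) * duhamelConst κ (gradExp p) ((p - 1) / 4) *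
              gradConst (gradExp p) * t ^ ((3 - p) / 8) * t ^ (-(1 / 4) : ℝ) := by ring
          _ ≤ 8 * Real.pi * M ^ (p - 1) * duhamelConst κ (gradExp p) ((p - 1) / 4) *
              gradConst (gradExp p) * T ^ ((3 - p) / 8) * t ^ (-(1 / 4) : ℝ) := by
            gcongr
          _ = _ := by ring
    -- Within `[0, T]` only `t = 0` remains, where the Duhamel integral vanishes and `u₀` itself is
    -- correct.
    · refine ⟨u₀, 0, fun ht' => ⟨fun k => ?_, fun h => absurd h ht⟩⟩
      have h0 : t = 0 := le_antisymm (not_lt.1 fun h => ht ⟨h, ht'.2⟩) ht'.1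
      rw [h0, heat_zero, duhamel, intervalIntegral.integral_same]
      simp
  choose u G h using key
  exact ⟨u, G, ⟨fun t ht => ((h t (Ioc_subset_Icc_self ht)).2 ht).1, fun t ht => (h t ht).1⟩,
    fun t ht => ((h t (Ioc_subset_Icc_self ht)).2 ht).2⟩

/-- The solution operator is Lipschitz continuous, with a small constant for short times. -/
theorem IsDuhamelStep.norm_sub_le (hκ : 0 < κ) (h2 : 2 < p) (h3 : p < 3) (hM : 0 ≤ M)
    {P' : ℝ → V2} {u' : ℝ → L2} {G' : ℝ → V2} (hP : IsAdmissible p T M P)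
    (hP' : IsAdmissible p T M P') (h : IsDuhamelStep κ p T u₀ P u G)
    (h' : IsDuhamelStep κ p T u₀ P' u' G') {D : ℝ} (hD : 0 ≤ D)
    (hPP : ∀ t ∈ Ioc 0 T, ‖P t - P' t‖ ≤ D * t ^ (-(1 / 4) : ℝ)) {t : ℝ} (ht : t ∈ Ioc 0 T) :
    ‖G t - G' t‖ ≤ stepConst κ p * M ^ (p - 2) * T ^ ((3 - p) / 8) * D *
      t ^ (-(1 / 4) : ℝ) := by
  have hpi := Real.pi_pos
  have hT : 0 ≤ T := ht.1.le.trans ht.2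
  have ha1 : gradExp p < 1 := by unfold gradExp; linarith
  have ha0 : 0 ≤ gradExp p := by unfold gradExp; linarith
  have hd := duhamelConst_pos hκ ha1 (by linarith : (p - 1) / 4 < 1)
  have hg := gradConst_nonneg (gradExp p)
  have ht' : t ∈ Icc 0 T := Ioc_subset_Icc_self ht
  have hsub : ∀ {Q}, IsAdmissible p T M Q → ∀ k,
      IntervalIntegrable (fun s => divFlux p (Q s) k) volume 0 t :=
    fun hQ k => (hQ.mono ht.1.le ht.2).integrable k
  have hA : 0 ≤ 8 * Real.pi * M ^ (p - 2) * D := by positivity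
  have hcoef : ∀ k, ‖fourierCoeffR (u t - u' t : L2) k‖ ≤
      8 * Real.pi * M ^ (p - 2) * D * duhamelConst κ (gradExp p) ((p - 1) / 4) *
        t ^ (1 - gradExp p - (p - 1) / 4) * weight (gradExp p) k := by
    intro k
    -- The free evolutions cancel since both steps start from `u₀`. The Duhamel terms enter with a
    -- minus sign, whence the order `P'`, `P`.
    have e : fourierCoeffR (u t - u' t : L2) k =
        duhamel κ (fun s k => divFlux p (P' s) k - divFlux p (P s) k) t k := by
      rw [fourierCoeffR_L2_sub, h.eq t ht', h'.eq t ht', duhamel_sub (hsub hP' k) (hsub hP k)]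
      ring
    rw [e]
    refine norm_duhamel_le hκ ha0 ha1 (by linarith) (by linarith) hA ht.1 fun s hs => ?_
    have hs' : s ∈ Ioc 0 T := ⟨hs.1, hs.2.le.trans ht.2⟩
    refine (norm_divFlux_sub_le h2 h3 (P' s) (P s) k).trans ?_
    have b1 := Real.rpow_le_rpow (norm_nonneg _) (hP.bound s hs') (by linarith : 0 ≤ p - 2)
    have b2 := Real.rpow_le_rpow (norm_nonneg _) (hP'.bound s hs') (by linarith : 0 ≤ p - 2)
    rw [rpow_mul_rpow_neg_quarter hM hs.1] at b1 b2
    have b3 := hPP s hs'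
    rw [norm_sub_rev] at b3
    have e2 : s ^ (-((p - 1) / 4)) = s ^ (-((p - 2) / 4)) * s ^ (-(1 / 4) : ℝ) := by
      rw [← Real.rpow_add hs.1]; congr 1; ring
    have h5 : 0 ≤ s ^ (-((p - 2) / 4)) := Real.rpow_nonneg hs.1.le _
    calc _ ≤ 4 * Real.pi * √(normSq k) *
          ((M ^ (p - 2) * s ^ (-((p - 2) / 4)) + M ^ (p - 2) * s ^ (-((p - 2) / 4))) *
            (D * s ^ (-(1 / 4) : ℝ))) := by gcongr
      _ = _ := by rw [e2]; ring
  have htp : 0 ≤ t ^ (1 - gradExp p - (p - 1) / 4) := Real.rpow_nonneg ht.1.le _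
  refine (((h.grad t ht).sub (h'.grad t ht)).norm_le_of_weight
    (by unfold gradExp; linarith : 3 / 4 < gradExp p) (by positivity) hcoef).trans ?_
  have hmono : t ^ ((3 - p) / 8) ≤ T ^ ((3 - p) / 8) :=
    Real.rpow_le_rpow ht.1.le ht.2 (by linarith)
  have h4 : 0 ≤ t ^ (-(1 / 4) : ℝ) := Real.rpow_nonneg ht.1.le _
  rw [rpow_gradExp ht.1]
  unfold stepConst
  calc _ = 8 * Real.pi * duhamelConst κ (gradExp p) ((p - 1) / 4) * gradConst (gradExp p) *
        M ^ (p - 2) * t ^ ((3 - p) / 8) * D * t ^ (-(1 / 4) : ℝ) := by ring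
    _ ≤ _ := by gcongr

end

/-! ### Equivalence of the coefficient form and the Bochner form of mild solutions. -/

/-- The Fourier coefficient as a continuous linear functional on `L²`. -/
def coeffCLM (k : Fin 2 → ℤ) : L2C →L[ℂ] ℂ := innerSL ℂ (UnitAddTorus.mFourierLp 2 k : L2C)

theorem coeffCLM_apply (k : Fin 2 → ℤ) (f : L2C) :
    coeffCLM k f = UnitAddTorus.mFourierCoeff f k := by
  rw [← UnitAddTorus.mFourierBasis_repr, UnitAddTorus.mFourierBasis.repr_apply_apply,
    UnitAddTorus.coe_mFourierBasis]
  rfl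

theorem coeffCLM_complexify (k : Fin 2 → ℤ) (f : L2) :
    coeffCLM k (complexify f) = fourierCoeffR f k := by
  rw [coeffCLM_apply, mFourierCoeff_complexify]

theorem coeffCLM_tsum {c : (Fin 2 → ℤ) → ℂ} (hc : Summable fun k => ‖c k‖ ^ 2) (k : Fin 2 → ℤ) :
    coeffCLM k (∑' k, c k • UnitAddTorus.mFourierLp 2 k) = c k := by
  obtain ⟨f, hf, hs⟩ := exists_L2C_of_summable hc
  rw [hs.tsum_eq, coeffCLM_apply, hf]

theorem norm_tsum_mFourierLp_le {c : (Fin 2 → ℤ) → ℂ} {w : (Fin 2 → ℤ) → ℝ} {B : ℝ} (hB : 0 ≤ B)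
    (hw : Summable fun k => w k ^ 2) (hc : ∀ k, ‖c k‖ ≤ B * w k) :
    ‖(∑' k, c k • UnitAddTorus.mFourierLp 2 k : L2C)‖ ≤ B * √(∑' k, w k ^ 2) := by
  have hle : ∀ k, ‖c k‖ ^ 2 ≤ B ^ 2 * w k ^ 2 := fun k => by
    rw [← mul_pow]
    exact pow_le_pow_left₀ (norm_nonneg _) (hc k) 2
  obtain ⟨f, hf, hs⟩ := exists_L2C_of_summable
    ((hw.mul_left (B ^ 2)).of_nonneg_of_le (fun k => sq_nonneg _) hle)
  rw [hs.tsum_eq]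
  refine le_of_sq_le_sq ?_ (by positivity)
  have h1 := UnitAddTorus.hasSum_sq_mFourierCoeff f
  simp_rw [hf] at h1
  have h2 : ∫ x, ‖f x‖ ^ 2 = ‖f‖ ^ 2 := by
    have := norm_sq_eq_re_inner (𝕜 := ℂ) f
    rw [this, L2.inner_def, ← integral_re (L2.integrable_inner f f)]
    refine integral_congr_ae (Eventually.of_forall fun x => ?_)
    exact norm_sq_eq_re_inner (𝕜 := ℂ) (f x)
  rw [← h2, mul_pow, Real.sq_sqrt (tsum_nonneg fun k => sq_nonneg _)]
  exact hasSum_le hle h1 (hw.hasSum.mul_left _)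

theorem coeffCLM_semigroup {κ t : ℝ} (hκ : 0 < κ) (ht : 0 ≤ t) (f : L2) (k : Fin 2 → ℤ) :
    coeffCLM k (semigroup κ t f) = heat κ t k * fourierCoeffR f k := by
  refine coeffCLM_tsum (c := fun k => (heat κ t k : ℂ) * fourierCoeffR f k) ?_ k
  refine (hasSum_sq_fourierCoeffR f).summable.of_nonneg_of_le (fun k => sq_nonneg _) fun k => ?_
  rw [norm_mul, Complex.norm_real, Real.norm_of_nonneg (heat_pos _ _ _).le]
  exact pow_le_pow_left₀ (mul_nonneg (heat_pos _ _ _).le (norm_nonneg _))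
    (mul_le_of_le_one_left (norm_nonneg _) (heat_le_one hκ ht k)) 2

theorem divSemigroup_flux (κ τ p : ℝ) (G : T2 → E2) :
    divSemigroup κ τ (flux p G) =
      ∑' k, ((heat κ τ k : ℂ) * divFlux p G k) • UnitAddTorus.mFourierLp 2 k := rfl

theorem V2.integral_norm_le (G : V2) : ∫ x, ‖G x‖ ≤ ‖G‖ := by
  have jensen : ∫ x, (‖G x‖ ^ 2) ^ (1 / 2 : ℝ) ≤ (∫ x, ‖G x‖ ^ 2) ^ (1 / 2 : ℝ) :=
    (Real.concaveOn_rpow (by norm_num) (by norm_num)).le_map_integral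
      (Real.continuous_rpow_const (by norm_num)).continuousOn isClosed_Ici
      (Eventually.of_forall fun x => sq_nonneg ‖G x‖) (V2.integrable_norm_sq G)
      (V2.integrable_norm_sq_rpow G (by norm_num) (by norm_num))
  simp_rw [← Real.sqrt_eq_rpow, Real.sqrt_sq (norm_nonneg _)] at jensen
  rwa [V2.integral_sq, Real.sqrt_sq (norm_nonneg _)] at jensen

theorem V2.continuous_integral_norm : Continuous fun G : V2 => ∫ x, ‖G x‖ := by
  refine (LipschitzWith.of_le_add fun G H => ?_ : LipschitzWith 1 _).continuous
  rw [dist_eq_norm]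
  refine le_trans ?_ (add_le_add le_rfl (V2.integral_norm_le (G - H)))
  rw [← integral_add (V2.integrable H).norm (V2.integrable (G - H)).norm]
  refine integral_mono_ae (V2.integrable G).norm
    ((V2.integrable H).norm.add (V2.integrable (G - H)).norm) ?_
  filter_upwards [Lp.coeFn_sub G H] with x hx
  simp only [hx, Pi.sub_apply]
  calc ‖G x‖ = ‖H x + (G x - H x)‖ := by rw [add_sub_cancel]
    _ ≤ _ := norm_add_le _ _

/-- A mild solution on `[0,T]` with gradient `G`, in terms of Fourier coefficients. -/
structure IsCoeffSolution (κ p T M : ℝ) (u₀ : L2) (u : ℝ → L2) (G : ℝ → V2) : Prop where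
  admissible : IsAdmissible p T M G
  step : IsDuhamelStep κ p T u₀ G u G

section

variable {κ p T M : ℝ} {u₀ : L2} {P : ℝ → V2} {u : ℝ → L2} {G : ℝ → V2}

theorem norm_heat_mul_divFlux_le (hκ : 0 < κ) (h2 : 2 < p) (h3 : p < 3) (hM : 0 ≤ M) {t s : ℝ}
    (hs : s ∈ Ioo 0 t) {Q : V2} (hQ : ‖Q‖ ≤ M * s ^ (-(1 / 4) : ℝ)) (k : Fin 2 → ℤ) :
    ‖(heat κ (t - s) k : ℂ) * divFlux p Q k‖ ≤
      4 * Real.pi * M ^ (p - 1) * κ ^ (-gradExp p) *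
        singularMajorant (gradExp p) ((p - 1) / 4) t s * weight (gradExp p) k := by
  have hpi := Real.pi_pos
  have ha0 : 0 ≤ gradExp p := by unfold gradExp; linarith
  have ha1 : gradExp p ≤ 1 := by unfold gradExp; linarith
  refine (norm_heat_mul_le hκ ha0 ha1 (by linarith : 0 ≤ (p - 1) / 4) (by positivity) hs k
    (norm_divFlux_le_of_norm_le h2 h3 hM hs.1 hQ k)).trans_eq ?_
  ring

theorem singularMajorant_nonneg {a b t s : ℝ} (hs : s ∈ Icc 0 t) : 0 ≤ singularMajorant a b t s := by
  have h1 : 0 ≤ t - s := sub_nonneg.2 hs.2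
  have h2 : 0 ≤ s := hs.1
  have h3 : 0 ≤ t := h2.trans hs.2
  unfold singularMajorant
  positivity

theorem summable_heat_mul_divFlux (hκ : 0 < κ) (h2 : 2 < p) (h3 : p < 3) (hM : 0 ≤ M) {t s : ℝ}
    (hs : s ∈ Ioo 0 t) {Q : V2} (hQ : ‖Q‖ ≤ M * s ^ (-(1 / 4) : ℝ)) :
    Summable fun k => ‖(heat κ (t - s) k : ℂ) * divFlux p Q k‖ ^ 2 := by
  refine ((summable_weight_sq (by unfold gradExp; linarith : 1 / 2 < gradExp p)).mul_left
    ((4 * Real.pi * M ^ (p - 1) * κ ^ (-gradExp p) *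
        singularMajorant (gradExp p) ((p - 1) / 4) t s) ^ 2)).of_nonneg_of_le
    (fun k => sq_nonneg _) fun k => ?_
  rw [← mul_pow]
  exact pow_le_pow_left₀ (norm_nonneg _) (norm_heat_mul_divFlux_le hκ h2 h3 hM hs hQ k) 2

theorem coeffCLM_divSemigroup (hκ : 0 < κ) (h2 : 2 < p) (h3 : p < 3) (hM : 0 ≤ M) {t s : ℝ}
    (hs : s ∈ Ioo 0 t) {Q : V2} (hQ : ‖Q‖ ≤ M * s ^ (-(1 / 4) : ℝ)) (k : Fin 2 → ℤ) :
    coeffCLM k (divSemigroup κ (t - s) (flux p Q)) = heat κ (t - s) k * divFlux p Q k := by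
  rw [divSemigroup_flux]
  exact coeffCLM_tsum (summable_heat_mul_divFlux hκ h2 h3 hM hs hQ) k

theorem divSemigroup_flux_congr_ae (κ τ p : ℝ) {G H : T2 → E2} (h : G =ᵐ[volume] H) :
    divSemigroup κ τ (flux p G) = divSemigroup κ τ (flux p H) := by
  simp_rw [divSemigroup_flux, divFlux_congr_ae p h]

theorem IsAdmissible.intervalIntegrable_divSemigroup (hκ : 0 < κ) (h2 : 2 < p) (h3 : p < 3)
    (hM : 0 ≤ M) (hP : IsAdmissible p T M P) {t : ℝ} (ht : t ∈ Icc 0 T) :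
    IntervalIntegrable (fun s => divSemigroup κ (t - s) (flux p (P s))) volume 0 t := by
  have hpi := Real.pi_pos
  rw [intervalIntegrable_iff_integrableOn_Ioo_of_le ht.1]
  set S := √(∑' k, weight (gradExp p) k ^ 2) with hS
  have hmaj : IntegrableOn (fun s => 4 * Real.pi * M ^ (p - 1) * κ ^ (-gradExp p) *
      singularMajorant (gradExp p) ((p - 1) / 4) t s * S) (Ioo 0 t) volume := by
    rw [← intervalIntegrable_iff_integrableOn_Ioo_of_le ht.1]
    exact ((intervalIntegrable_singularMajorant (by unfold gradExp; linarith) (by linarith)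
      t).const_mul _).mul_const _
  have hmeas : AEStronglyMeasurable (fun s => divSemigroup κ (t - s) (flux p (P s)))
      (volume.restrict (Ioo 0 t)) := by
    -- Strong measurability comes from the finite partial Fourier sums, so only measurability of the
    -- scalar coefficients is needed.
    refine aestronglyMeasurable_of_tendsto_ae (u := (atTop : Filter (Finset (Fin 2 → ℤ))))
      (f := fun F s => ∑ k ∈ F, ((heat κ (t - s) k : ℂ) * divFlux p (P s) k) •
        (UnitAddTorus.mFourierLp 2 k : L2C)) (fun F => ?_) ?_
    · refine Finset.aestronglyMeasurable_fun_sum F fun k _ => ?_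
      have h1 := (hP.mono ht.1 ht.2).integrable k
      have h2 := intervalIntegrable_heat_mul (κ := κ) h1
        (continuous_const.sub continuous_id : Continuous fun s : ℝ => t - s) k
      rw [intervalIntegrable_iff_integrableOn_Ioo_of_le ht.1] at h2
      exact h2.aestronglyMeasurable.smul_const _
    · filter_upwards [ae_restrict_mem measurableSet_Ioo] with s hs
      obtain ⟨f, -, hf⟩ := exists_L2C_of_summable
        (summable_heat_mul_divFlux hκ h2 h3 hM hs (hP.bound s ⟨hs.1, hs.2.le.trans ht.2⟩))
      rw [divSemigroup_flux, hf.tsum_eq]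
      exact hf
  refine hmaj.mono' hmeas ?_
  filter_upwards [ae_restrict_mem measurableSet_Ioo] with s hs
  have := singularMajorant_nonneg (a := gradExp p) (b := (p - 1) / 4) (Ioo_subset_Icc_self hs)
  exact norm_tsum_mFourierLp_le (by positivity)
    (summable_weight_sq (by unfold gradExp; linarith))
    (norm_heat_mul_divFlux_le hκ h2 h3 hM hs (hP.bound s ⟨hs.1, hs.2.le.trans ht.2⟩))

theorem IsAdmissible.coeffCLM_integral (hκ : 0 < κ) (h2 : 2 < p) (h3 : p < 3)
    (hM : 0 ≤ M) (hP : IsAdmissible p T M P) {t : ℝ} (ht : t ∈ Icc 0 T) (k : Fin 2 → ℤ) :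
    coeffCLM k (∫ s in (0 : ℝ)..t, divSemigroup κ (t - s) (flux p (P s))) =
      duhamel κ (fun s => divFlux p (P s)) t k := by
  rw [← ContinuousLinearMap.intervalIntegral_comp_comm _
    (hP.intervalIntegrable_divSemigroup hκ h2 h3 hM ht), duhamel]
  refine intervalIntegral.integral_congr_ae ?_
  have : ∀ᵐ s : ℝ, s ≠ t := by simp [ae_iff]
  filter_upwards [this] with s hst hs
  rw [uIoc_of_le ht.1] at hs
  exact coeffCLM_divSemigroup hκ h2 h3 hM ⟨hs.1, lt_of_le_of_ne hs.2 hst⟩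
    (hP.bound s ⟨hs.1, hs.2.trans ht.2⟩) k

/-- The singular majorant gives Bochner integrability; the functionals `coeffCLM k` then commute
with the integral and separate points, so the equation may be checked frequency by frequency. -/
theorem IsCoeffSolution.isMildSolutionInS (hκ : 0 < κ) (h2 : 2 < p) (h3 : p < 3)
    (hM : 0 ≤ M) (hT : 0 ≤ T) (h : IsCoeffSolution κ p T M u₀ u G) :
    IsMildSolutionInS κ p T u₀ u := by
  obtain ⟨hG, hu⟩ := h
  have hae : ∀ t ∈ Ioc 0 T, weakGradient (u t) =ᵐ[volume] G t := fun t ht =>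
    (hu.grad t ht).weakGradient_ae_eq
  have hds : ∀ t ∈ Icc 0 T, ∀ᵐ s, s ∈ uIoc 0 t →
      divSemigroup κ (t - s) (flux p (G s)) =
      divSemigroup κ (t - s) (flux p (weakGradient (u s))) := by
    intro t ht
    refine Eventually.of_forall fun s hs => ?_
    rw [uIoc_of_le ht.1] at hs
    exact (divSemigroup_flux_congr_ae _ _ _ (hae s ⟨hs.1, hs.2.trans ht.2⟩)).symm
  refine ⟨⟨hu.continuousOn hκ h2 h3 hM hT hG, ?_, ?_, ?_, ?_, ?_⟩, ?_, ?_⟩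
  · filter_upwards [ae_restrict_mem measurableSet_Ioo] with t ht
    exact ⟨G t, hu.grad t (Ioo_subset_Ioc_self ht)⟩
  · have hc : ContinuousOn (fun t => ∫ x, ‖weakGradient (u t) x‖) (Ioo 0 T) := by
      refine ContinuousOn.congr (V2.continuous_integral_norm.comp_continuousOn
        ((hu.continuousOn_grad hκ h2 h3 hM hT hG).mono Ioo_subset_Ioc_self)) fun t ht => ?_
      refine integral_congr_ae ?_
      filter_upwards [hae t (Ioo_subset_Ioc_self ht)] with x hx
      rw [hx]
    exact hc.locallyIntegrableOn measurableSet_Ioo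
  · filter_upwards [ae_restrict_mem measurableSet_Ioo] with t ht
    exact (integrable_flux h2 h3 (G t)).congr
      (flux_congr_ae p (hae t (Ioo_subset_Ioc_self ht))).symm
  · intro t ht
    refine (hG.intervalIntegrable_divSemigroup hκ h2 h3 hM ht).congr_ae ?_
    rw [EventuallyEq, ae_restrict_iff' measurableSet_uIoc]
    exact hds t ht
  · intro t ht
    apply L2C_ext
    intro k
    rw [← coeffCLM_apply, ← coeffCLM_apply, map_sub, coeffCLM_complexify,
      coeffCLM_semigroup hκ ht.1, ← intervalIntegral.integral_congr_ae (hds t ht),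
      hG.coeffCLM_integral hκ h2 h3 hM ht, hu.eq t ht]
  · exact fun t ht => ⟨G t, hu.grad t ht⟩
  · refine lt_of_le_of_lt (b := ENNReal.ofReal M) ?_ ENNReal.ofReal_lt_top
    refine iSup₂_le fun t ht => ?_
    rw [eLpNorm_congr_ae (hae t ht), ← Lp.enorm_def, ← ofReal_norm,
      ← ENNReal.ofReal_mul (Real.rpow_nonneg ht.1.le _)]
    refine ENNReal.ofReal_le_ofReal ?_
    have := mul_le_mul_of_nonneg_left (hG.bound t ht) (Real.rpow_nonneg ht.1.le (1 / 4))
    refine this.trans_eq ?_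
    rw [mul_left_comm, ← Real.rpow_add ht.1]
    norm_num

/-- The finite supremum shows that the gradient is in `L²` at every positive time and serves as `M`;
applying `coeffCLM k` to the equation gives the coefficient identities. -/
theorem IsMildSolutionInS.exists_isCoeffSolution (hκ : 0 < κ) (h2 : 2 < p) (h3 : p < 3)
    (hT : 0 ≤ T) (h : IsMildSolutionInS κ p T u₀ u) :
    ∃ M G, 0 ≤ M ∧ IsCoeffSolution κ p T M u₀ u G := by
  obtain ⟨hmild, hgrad, hsup⟩ := h
  set C := ⨆ t ∈ Ioc 0 T, ENNReal.ofReal (t ^ (1 / 4 : ℝ)) *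
    eLpNorm (weakGradient (u t)) 2 volume with hC
  have hle : ∀ t ∈ Ioc 0 T, ENNReal.ofReal (t ^ (1 / 4 : ℝ)) *
      eLpNorm (weakGradient (u t)) 2 volume ≤ C := fun t ht =>
    le_iSup₂ (f := fun t (_ : t ∈ Ioc 0 T) => ENNReal.ofReal (t ^ (1 / 4 : ℝ)) *
      eLpNorm (weakGradient (u t)) 2 volume) t ht
  have hmem : ∀ t ∈ Ioc 0 T, MemLp (weakGradient (u t)) 2 volume := by
    intro t ht
    refine ⟨(hgrad t ht).isWeakGradient.integrable.aestronglyMeasurable, ?_⟩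
    by_contra htop
    rw [not_lt, top_le_iff] at htop
    have := hle t ht
    rw [htop, ENNReal.mul_top, top_le_iff] at this
    · exact hsup.ne this
    · simpa using Real.rpow_pos_of_pos ht.1 _
  classical
  let G : ℝ → V2 := fun t =>
    if ht : MemLp (weakGradient (u t)) 2 volume then ht.toLp _ else 0
  have hG : ∀ t ∈ Ioc 0 T, weakGradient (u t) =ᵐ[volume] G t := by
    intro t ht
    simp only [G, dif_pos (hmem t ht)]
    exact (hmem t ht).coeFn_toLp.symm
  have hbound : ∀ t ∈ Ioc 0 T, ‖G t‖ ≤ C.toReal * t ^ (-(1 / 4) : ℝ) := by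
    intro t ht
    have h1 := hle t ht
    rw [eLpNorm_congr_ae (hG t ht), ← Lp.enorm_def, ← ofReal_norm,
      ← ENNReal.ofReal_mul (Real.rpow_nonneg ht.1.le _),
      ENNReal.ofReal_le_iff_le_toReal hsup.ne] at h1
    have h5 := mul_le_mul_of_nonneg_right h1 (Real.rpow_nonneg ht.1.le (-(1 / 4)))
    refine le_trans (le_of_eq ?_) h5
    rw [mul_right_comm, ← Real.rpow_add ht.1]
    norm_num
  have hM : 0 ≤ C.toReal := ENNReal.toReal_nonneg
  have hint : ∀ k, IntervalIntegrable (fun s => divFlux p (G s) k) volume 0 T := by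
    intro k
    have h1 := hmild.intervalIntegrable T ⟨hT, le_rfl⟩
    rw [intervalIntegrable_iff_integrableOn_Ioo_of_le hT] at h1
    have h4 : IntervalIntegrable (fun s => (heat κ (T - s) k : ℂ) * divFlux p (G s) k)
        volume 0 T := by
      rw [intervalIntegrable_iff_integrableOn_Ioo_of_le hT]
      refine ((coeffCLM k).integrable_comp h1).congr ?_
      filter_upwards [ae_restrict_mem measurableSet_Ioo] with s hs
      have hs' := Ioo_subset_Ioc_self hs
      rw [divSemigroup_flux_congr_ae _ _ _ (hG s hs')]
      exact coeffCLM_divSemigroup hκ h2 h3 hM hs (hbound s hs') k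
    -- Bochner integrability at the final time `T` controls `heat κ (T - s) k` times the
    -- coefficient. Multiplying by the inverse `heat κ (s - T) k`, continuous in `s` for fixed `k`,
    -- removes the semigroup.
    have hτ : Continuous fun s : ℝ => s - T := continuous_id.sub continuous_const
    refine (intervalIntegrable_heat_mul (κ := κ) h4 hτ k).congr fun s _ => ?_
    rw [← mul_assoc, ← Complex.ofReal_mul, ← heat_add, sub_add_sub_cancel, sub_self, heat_zero,
      Complex.ofReal_one, one_mul]
  have hadm : IsAdmissible p T C.toReal G := ⟨hbound, hint⟩
  refine ⟨C.toReal, G, hM, hadm,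
    fun t ht => (hgrad t ht).isWeakGradient.congr_right (hG t ht), fun t ht k => ?_⟩
  have hds : ∀ᵐ s, s ∈ uIoc 0 t →
      divSemigroup κ (t - s) (flux p (weakGradient (u s))) =
      divSemigroup κ (t - s) (flux p (G s)) := by
    refine Eventually.of_forall fun s hs => ?_
    rw [uIoc_of_le ht.1] at hs
    exact divSemigroup_flux_congr_ae _ _ _ (hG s ⟨hs.1, hs.2.trans ht.2⟩)
  have := congrArg (coeffCLM k) (hmild.equation t ht)
  rw [map_sub, coeffCLM_complexify, coeffCLM_semigroup hκ ht.1,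
    intervalIntegral.integral_congr_ae hds, hadm.coeffCLM_integral hκ h2 h3 hM ht] at this
  exact this

end

/-! ### Restarting and uniqueness. -/

section

variable {κ p T M : ℝ} {u₀ : L2} {P : ℝ → V2} {u : ℝ → L2} {G : ℝ → V2}

theorem duhamel_congr {t : ℝ} (ht : 0 ≤ t) {φ ψ : ℝ → (Fin 2 → ℤ) → ℂ} {k : Fin 2 → ℤ}
    (h : ∀ s ∈ Ioc 0 t, φ s k = ψ s k) : duhamel κ φ t k = duhamel κ ψ t k := by
  refine intervalIntegral.integral_congr_ae (Eventually.of_forall fun s hs => ?_)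
  rw [uIoc_of_le ht] at hs
  simp only [h s hs]

theorem duhamel_add {τ t : ℝ} (hτ : 0 ≤ τ) (ht : 0 ≤ t) {φ : ℝ → (Fin 2 → ℤ) → ℂ}
    {k : Fin 2 → ℤ} (hφ : IntervalIntegrable (fun s => φ s k) volume 0 (τ + t)) :
    duhamel κ φ (τ + t) k =
      heat κ t k * duhamel κ φ τ k + duhamel κ (fun s => φ (τ + s)) t k := by
  have hc : Continuous fun s : ℝ => τ + t - s := continuous_const.sub continuous_id
  have hi := intervalIntegrable_heat_mul (κ := κ) hφ hc k
  have h1 : IntervalIntegrable (fun s => (heat κ (τ + t - s) k : ℂ) * φ s k) volume 0 τ :=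
    hi.mono_set (by
      rw [uIcc_of_le hτ, uIcc_of_le (by linarith)]
      exact Icc_subset_Icc_right (by linarith))
  have h2 : IntervalIntegrable (fun s => (heat κ (τ + t - s) k : ℂ) * φ s k) volume τ (τ + t) :=
    hi.mono_set (by
      rw [uIcc_of_le (by linarith), uIcc_of_le (by linarith)]
      exact Icc_subset_Icc_left hτ)
  unfold duhamel
  rw [← intervalIntegral.integral_add_adjacent_intervals h1 h2,
    ← intervalIntegral.integral_const_mul]
  congr 1
  · refine intervalIntegral.integral_congr fun s _ => ?_
    simp only [show τ + t - s = t + (τ - s) by ring, heat_add κ t]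
    push_cast
    ring
  · have := intervalIntegral.integral_comp_add_left (a := 0) (b := t)
      (fun s => (heat κ (τ + t - s) k : ℂ) * φ s k) τ
    rw [add_zero] at this
    rw [← this]
    refine intervalIntegral.integral_congr fun s _ => ?_
    simp only [show τ + t - (τ + s) = t - s by ring]

theorem IsCoeffSolution.mono_time (h : IsCoeffSolution κ p T M u₀ u G) {T' : ℝ} (h0 : 0 ≤ T')
    (hT : T' ≤ T) : IsCoeffSolution κ p T' M u₀ u G :=
  ⟨h.admissible.mono h0 hT, fun t ht => h.step.grad t ⟨ht.1, ht.2.trans hT⟩,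
    fun t ht => h.step.eq t ⟨ht.1, ht.2.trans hT⟩⟩

theorem IsCoeffSolution.mono_bound (h : IsCoeffSolution κ p T M u₀ u G) {M' : ℝ} (hM : M ≤ M') :
    IsCoeffSolution κ p T M' u₀ u G :=
  ⟨⟨fun t ht => (h.admissible.bound t ht).trans
    (mul_le_mul_of_nonneg_right hM (Real.rpow_nonneg ht.1.le _)), h.admissible.integrable⟩, h.step⟩

theorem IsCoeffSolution.congr (h : IsCoeffSolution κ p T M u₀ u G) {v : ℝ → L2}
    (huv : ∀ t ∈ Icc 0 T, v t = u t) : IsCoeffSolution κ p T M u₀ v G :=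
  ⟨h.admissible, fun t ht => by
      rw [huv t (Ioc_subset_Icc_self ht)]
      exact h.step.grad t ht,
    fun t ht => by
      rw [huv t ht]
      exact h.step.eq t ht⟩

theorem IsCoeffSolution.apply_zero (h : IsCoeffSolution κ p T M u₀ u G) (hT : 0 ≤ T) :
    u 0 = u₀ := by
  refine L2_ext fun k => ?_
  rw [h.step.eq 0 ⟨le_rfl, hT⟩, heat_zero, duhamel, intervalIntegral.integral_same]
  simp

/-- The semigroup law splits the Duhamel integral at `τ`. As `t^(-1/4)` is decreasing, the constant
`M` survives the shift, so a step length determined by `M` can be reused after each restart. -/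
theorem IsCoeffSolution.shift (hM : 0 ≤ M) (h : IsCoeffSolution κ p T M u₀ u G) {τ : ℝ}
    (h0 : 0 ≤ τ) (hT : τ ≤ T) :
    IsCoeffSolution κ p (T - τ) M (u τ) (fun t => u (τ + t)) (fun t => G (τ + t)) := by
  refine ⟨⟨fun t ht => ?_, fun k => ?_⟩, fun t ht => ?_, fun t ht k => ?_⟩
  · refine (h.admissible.bound (τ + t) ⟨by linarith [ht.1], by linarith [ht.2]⟩).trans ?_
    exact mul_le_mul_of_nonneg_left
      (Real.rpow_le_rpow_of_nonpos ht.1 (by linarith) (by norm_num)) hM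
  · have h1 : IntervalIntegrable (fun s => divFlux p (G s) k) volume τ T :=
      (h.admissible.integrable k).mono_set (by
        rw [uIcc_of_le hT, uIcc_of_le (h0.trans hT)]
        exact Icc_subset_Icc_left h0)
    have := h1.comp_add_left τ
    rwa [sub_self] at this
  · exact h.step.grad (τ + t) ⟨by linarith [ht.1], by linarith [ht.2]⟩
  · have hτt : τ + t ≤ T := by linarith [ht.2]
    have hτt0 : 0 ≤ τ + t := by linarith [ht.1]
    rw [h.step.eq (τ + t) ⟨hτt0, hτt⟩, h.step.eq τ ⟨h0, hT⟩,
      duhamel_add h0 ht.1 ((h.admissible.mono hτt0 hτt).integrable k), add_comm τ t, heat_add]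
    push_cast
    ring

theorem exists_small_time (h3 : p < 3) (C : ℝ) :
    ∃ τ : ℝ, 0 < τ ∧ C * τ ^ ((3 - p) / 8) ≤ 1 / 2 := by
  have hθ : 0 < (3 - p) / 8 := by linarith
  have hc : Tendsto (fun τ : ℝ => C * τ ^ ((3 - p) / 8)) (𝓝[>] 0) (𝓝 0) := by
    have := ((Real.continuous_rpow_const hθ.le).tendsto 0).const_mul C
    rw [Real.zero_rpow hθ.ne', mul_zero] at this
    exact this.mono_left nhdsWithin_le_nhds
  have h1 := hc.eventually (Iic_mem_nhds (by norm_num : (0 : ℝ) < 1 / 2))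
  obtain ⟨τ, hτ, hτ0⟩ := (h1.and self_mem_nhdsWithin).exists
  exact ⟨τ, hτ0, hτ⟩

theorem rpow_le_rpow_theta (h3 : p < 3) {C τ T : ℝ} (hC : 0 ≤ C) (hT : 0 ≤ T) (hτ : T ≤ τ)
    (h : C * τ ^ ((3 - p) / 8) ≤ 1 / 2) : C * T ^ ((3 - p) / 8) ≤ 1 / 2 :=
  (mul_le_mul_of_nonneg_left (Real.rpow_le_rpow hT hτ (by linarith)) hC).trans h

theorem eq_of_forall_norm_sub_le {E : Type*} [NormedAddCommGroup E] {x y : E} {C : ℝ}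
    (h : ∀ n : ℕ, ‖x - y‖ ≤ C * (1 / 2) ^ n) : x = y := by
  have hlim : Tendsto (fun n : ℕ => C * (1 / 2 : ℝ) ^ n) atTop (𝓝 0) := by
    simpa using (tendsto_pow_atTop_nhds_zero_of_lt_one (by norm_num : (0 : ℝ) ≤ 1 / 2)
      (by norm_num)).const_mul C
  have := ge_of_tendsto' hlim h
  rwa [norm_le_zero_iff, sub_eq_zero] at this

/-- Both gradients are fixed points of one contraction, so the trivial bound `2 M t^(-1/4)` on their
difference can be halved indefinitely. Equal gradients give equal Duhamel terms. -/
theorem IsCoeffSolution.eq_of_small (hκ : 0 < κ) (h2 : 2 < p) (h3 : p < 3) (hM : 0 ≤ M)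
    {u' : ℝ → L2} {G' : ℝ → V2} (h : IsCoeffSolution κ p T M u₀ u G)
    (h' : IsCoeffSolution κ p T M u₀ u' G')
    (hsmall : stepConst κ p * M ^ (p - 2) * T ^ ((3 - p) / 8) ≤ 1 / 2) :
    ∀ t ∈ Icc 0 T, u t = u' t := by
  have key : ∀ n : ℕ, ∀ t ∈ Ioc 0 T, ‖G t - G' t‖ ≤ 2 * M * (1 / 2) ^ n * t ^ (-(1 / 4) : ℝ) := by
    intro n
    induction n with
    | zero =>
      intro t ht
      refine (norm_sub_le _ _).trans ((add_le_add (h.admissible.bound t ht)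
        (h'.admissible.bound t ht)).trans_eq ?_)
      ring
    | succ n ih =>
      intro t ht
      refine (h.step.norm_sub_le hκ h2 h3 hM h.admissible h'.admissible h'.step
        (by positivity) ih ht).trans ?_
      have h4 : 0 ≤ t ^ (-(1 / 4) : ℝ) := Real.rpow_nonneg ht.1.le _
      calc _ ≤ 1 / 2 * (2 * M * (1 / 2) ^ n) * t ^ (-(1 / 4) : ℝ) := by gcongr
        _ = _ := by ring
  have hG : ∀ t ∈ Ioc 0 T, G t = G' t := fun t ht =>
    eq_of_forall_norm_sub_le (C := 2 * M * t ^ (-(1 / 4) : ℝ)) fun n =>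
      (key n t ht).trans_eq (by ring)
  intro t ht
  refine L2_ext fun k => ?_
  rw [h.step.eq t ht, h'.step.eq t ht]
  congr 1
  refine duhamel_congr ht.1 fun s hs => ?_
  rw [hG s ⟨hs.1, hs.2.trans ht.2⟩]

theorem IsCoeffSolution.eq (hκ : 0 < κ) (h2 : 2 < p) (h3 : p < 3) {M' : ℝ} (hM : 0 ≤ M)
    {u' : ℝ → L2} {G' : ℝ → V2} (h : IsCoeffSolution κ p T M u₀ u G)
    (h' : IsCoeffSolution κ p T M' u₀ u' G') : ∀ t ∈ Icc 0 T, u t = u' t := by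
  wlog hMM : M = M' generalizing M M'
  · exact this (hM.trans (le_max_left M M')) (h.mono_bound (le_max_left _ _))
      (h'.mono_bound (le_max_right M M')) rfl
  subst hMM
  have hC : 0 ≤ stepConst κ p * M ^ (p - 2) :=
    mul_nonneg (stepConst_nonneg hκ h2 h3) (Real.rpow_nonneg hM _)
  obtain ⟨τ, hτ0, hτ⟩ := exists_small_time h3 (stepConst κ p * M ^ (p - 2))
  -- Induction on the number of steps of length `τ`. The initial value varies because each restart
  -- begins from the common value `u τ`; `M` and `τ` stay fixed.
  have key : ∀ n : ℕ, ∀ (T : ℝ) (u₀ : L2) (u u' : ℝ → L2) (G G' : ℝ → V2), T ≤ n * τ →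
      IsCoeffSolution κ p T M u₀ u G → IsCoeffSolution κ p T M u₀ u' G' →
      ∀ t ∈ Icc 0 T, u t = u' t := by
    intro n
    induction n with
    | zero =>
      intro T u₀ u u' G G' hT h h' t ht
      have hT0 : 0 ≤ T := ht.1.trans ht.2
      have ht0 : t = 0 := le_antisymm (ht.2.trans (by simpa using hT)) ht.1
      rw [ht0, h.apply_zero hT0, h'.apply_zero hT0]
    | succ n ih =>
      intro T u₀ u u' G G' hT h h' t ht
      have hT0 : 0 ≤ T := ht.1.trans ht.2
      rcases le_total T τ with hTτ | hTτ
      · exact h.eq_of_small hκ h2 h3 hM h' (rpow_le_rpow_theta h3 hC hT0 hTτ hτ) t ht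
      · have h1 := (h.mono_time hτ0.le hTτ).eq_of_small hκ h2 h3 hM (h'.mono_time hτ0.le hTτ) hτ
        rcases le_total t τ with htτ | htτ
        · exact h1 t ⟨ht.1, htτ⟩
        · have hs := h.shift hM hτ0.le hTτ
          have hs' := h'.shift hM hτ0.le hTτ
          rw [← h1 τ ⟨hτ0.le, le_rfl⟩] at hs'
          have := ih (T - τ) (u τ) _ _ _ _ (by push_cast at hT; linarith) hs hs' (t - τ)
            ⟨by linarith, by linarith [ht.2]⟩
          simpa using this
  obtain ⟨n, hn⟩ := exists_nat_ge (T / τ)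
  exact key n T u₀ u u' G G' ((div_le_iff₀ hτ0).1 hn) h h'

/-! ### Local existence and gluing. -/

theorem IsAdmissible.of_aestronglyMeasurable (h2 : 2 < p) (h3 : p < 3) (hM : 0 ≤ M) (hT : 0 ≤ T)
    (hb : ∀ t ∈ Ioc 0 T, ‖P t‖ ≤ M * t ^ (-(1 / 4) : ℝ))
    (hm : ∀ k, AEStronglyMeasurable (fun s => divFlux p (P s) k) (volume.restrict (Ioc 0 T))) :
    IsAdmissible p T M P := by
  refine ⟨hb, fun k => ?_⟩
  rw [intervalIntegrable_iff_integrableOn_Ioc_of_le hT]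
  have h1 : IntegrableOn (fun s : ℝ => 4 * Real.pi * M ^ (p - 1) * √(normSq k) *
      s ^ (-((p - 1) / 4))) (Ioc 0 T) volume := by
    rw [← intervalIntegrable_iff_integrableOn_Ioc_of_le hT]
    exact (intervalIntegral.intervalIntegrable_rpow' (by linarith)).const_mul _
  refine h1.mono' (hm k) ?_
  filter_upwards [ae_restrict_mem measurableSet_Ioc] with s hs
  exact norm_divFlux_le_of_norm_le h2 h3 hM hs.1 (hb s hs) k

theorem IsAdmissible.of_continuousOn (h2 : 2 < p) (h3 : p < 3) (hM : 0 ≤ M) (hT : 0 ≤ T)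
    (hb : ∀ t ∈ Ioc 0 T, ‖P t‖ ≤ M * t ^ (-(1 / 4) : ℝ)) (hc : ContinuousOn P (Ioc 0 T)) :
    IsAdmissible p T M P :=
  .of_aestronglyMeasurable h2 h3 hM hT hb fun k =>
    ((continuous_divFlux h2 h3 k).comp_continuousOn hc).aestronglyMeasurable measurableSet_Ioc

/-- Picard iteration from the zero field. The order of quantifiers is the point: `δ` and `M` depend
on `R` alone, and the blow-up criterion rests on this uniformity. -/
theorem exists_isCoeffSolution (hκ : 0 < κ) (h2 : 2 < p) (h3 : p < 3) {R : ℝ} (hR : 0 ≤ R) :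
    ∃ δ M : ℝ, 0 < δ ∧ 0 ≤ M ∧ ∀ u₀ : L2, ‖u₀‖ ≤ R →
      ∃ u G, IsCoeffSolution κ p δ M u₀ u G := by
  have hfree : 0 ≤ freeConst κ := by
    have := Real.pi_pos
    unfold freeConst
    positivity
  have hstep := stepConst_nonneg hκ h2 h3
  -- The free evolution uses at most half of `M` and, by the choice of `T`, so does the Duhamel
  -- term. The summand `1` keeps `M` positive when `R = 0`.
  set M := 2 * (freeConst κ * R) + 1 with hMdef
  have hM0 : 0 < M := by positivity
  have hM := hM0.le
  obtain ⟨T, hT0, hT⟩ := exists_small_time h3 (stepConst κ p * M ^ (p - 2))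
  refine ⟨T, M, hT0, hM, fun u₀ hu₀ => ?_⟩
  have hself : freeConst κ * ‖u₀‖ + stepConst κ p * M ^ (p - 1) * T ^ ((3 - p) / 8) ≤ M := by
    have e : M ^ (p - 1) = M ^ (p - 2) * M := by
      rw [show p - 1 = (p - 2) + 1 by ring, Real.rpow_add hM0, Real.rpow_one]
    have h4 : freeConst κ * ‖u₀‖ ≤ freeConst κ * R := mul_le_mul_of_nonneg_left hu₀ hfree
    have h5 := mul_le_mul_of_nonneg_right hT hM
    rw [e]
    nlinarith
  have hnext : ∀ P : {P : ℝ → V2 // IsAdmissible p T M P},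
      ∃ (u : ℝ → L2) (G : {P : ℝ → V2 // IsAdmissible p T M P}),
        IsDuhamelStep κ p T u₀ P.1 u G.1 := by
    rintro ⟨P, hP⟩
    obtain ⟨u, G, hu, hb⟩ := exists_duhamelStep hκ h2 h3 hM hT0.le u₀ hP
    refine ⟨u, ⟨G, .of_continuousOn h2 h3 hM hT0.le (fun t ht => (hb t ht).trans ?_)
      (hu.continuousOn_grad hκ h2 h3 hM hT0.le hP)⟩, hu⟩
    exact mul_le_mul_of_nonneg_right hself (Real.rpow_nonneg ht.1.le _)
  choose U Φ hΦ using hnext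
  have hzero : IsAdmissible p T M (fun _ => 0) := by
    refine .of_continuousOn h2 h3 hM hT0.le (fun t ht => ?_) continuousOn_const
    rw [norm_zero]
    exact mul_nonneg hM (Real.rpow_nonneg ht.1.le _)
  set X : ℕ → {P : ℝ → V2 // IsAdmissible p T M P} := fun n => Φ^[n] ⟨_, hzero⟩ with hX
  have hXs : ∀ n, X (n + 1) = Φ (X n) := fun n => Function.iterate_succ_apply' Φ n _
  have hlip : ∀ {P P' : ℝ → V2} {u u' : ℝ → L2} {G G' : ℝ → V2}, IsAdmissible p T M P →
      IsAdmissible p T M P' → IsDuhamelStep κ p T u₀ P u G → IsDuhamelStep κ p T u₀ P' u' G' →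
      ∀ {D : ℝ}, 0 ≤ D → (∀ t ∈ Ioc 0 T, ‖P t - P' t‖ ≤ D * t ^ (-(1 / 4) : ℝ)) →
      ∀ t ∈ Ioc 0 T, ‖G t - G' t‖ ≤ 1 / 2 * D * t ^ (-(1 / 4) : ℝ) := by
    intro P P' u u' G G' hP hP' h h' D hD hd t ht
    refine (h.norm_sub_le hκ h2 h3 hM hP hP' h' hD hd ht).trans ?_
    have h4 : 0 ≤ t ^ (-(1 / 4) : ℝ) := Real.rpow_nonneg ht.1.le _
    gcongr
  have hgeom : ∀ n : ℕ, ∀ t ∈ Ioc 0 T,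
      ‖(X n).1 t - (X (n + 1)).1 t‖ ≤ 2 * M * (1 / 2) ^ n * t ^ (-(1 / 4) : ℝ) := by
    intro n
    induction n with
    | zero =>
      intro t ht
      refine (norm_sub_le _ _).trans ((add_le_add ((X 0).2.bound t ht)
        ((X 1).2.bound t ht)).trans_eq ?_)
      ring
    | succ n ih =>
      intro t ht
      rw [hXs (n + 1), hXs n]
      refine (hlip (X n).2 (Φ (X n)).2 (hΦ _) (hΦ _) (D := 2 * M * (1 / 2) ^ n) (by positivity)
        (fun t ht => by rw [← hXs]; exact ih t ht) t ht).trans_eq ?_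
      ring
  have hdist : ∀ t ∈ Ioc 0 T, ∀ n, dist ((X n).1 t) ((X (n + 1)).1 t) ≤
      2 * M * t ^ (-(1 / 4) : ℝ) * (1 / 2) ^ n := fun t ht n => by
    rw [dist_eq_norm]
    exact (hgeom n t ht).trans_eq (by ring)
  have hlim : ∀ t, ∃ g : V2, t ∈ Ioc 0 T → Tendsto (fun n => (X n).1 t) atTop (𝓝 g) := by
    intro t
    by_cases ht : t ∈ Ioc 0 T
    · obtain ⟨g, hg⟩ := cauchySeq_tendsto_of_complete
        (cauchySeq_of_le_geometric (1 / 2) _ (by norm_num) (hdist t ht))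
      exact ⟨g, fun _ => hg⟩
    · exact ⟨0, fun h => absurd h ht⟩
  choose G hG using hlim
  have hGdist : ∀ n : ℕ, ∀ t ∈ Ioc 0 T,
      ‖(X n).1 t - G t‖ ≤ 4 * M * (1 / 2) ^ n * t ^ (-(1 / 4) : ℝ) := by
    intro n t ht
    rw [← dist_eq_norm]
    refine (dist_le_of_le_geometric_of_tendsto (1 / 2) _ (by norm_num) (hdist t ht) (hG t ht)
      n).trans_eq ?_
    ring
  have hGadm : IsAdmissible p T M G := by
    refine .of_aestronglyMeasurable h2 h3 hM hT0.le (fun t ht => ?_) fun k => ?_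
    · exact le_of_tendsto' (hG t ht).norm fun n => (X n).2.bound t ht
    -- Since `IsAdmissible` asks for measurability of the coefficients only, pointwise convergence
    -- of the iterates and continuity of `divFlux` pass it to the limit.
    · refine aestronglyMeasurable_of_tendsto_ae (u := (atTop : Filter ℕ))
        (f := fun n s => divFlux p ((X n).1 s) k) (fun n => ?_) ?_
      · have := (X n).2.integrable k
        rw [intervalIntegrable_iff_integrableOn_Ioc_of_le hT0.le] at this
        exact this.aestronglyMeasurable
      · filter_upwards [ae_restrict_mem measurableSet_Ioc] with s hs
        exact ((continuous_divFlux h2 h3 k).tendsto _).comp (hG s hs)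
  refine ⟨U ⟨G, hGadm⟩, G, hGadm, fun t ht => ?_, (hΦ ⟨G, hGadm⟩).eq⟩
  -- By the Lipschitz bound the iterates converge to the image of `G` as well as to `G`. Hence `G`
  -- is the gradient of the function produced from it.
  have hfix : (Φ ⟨G, hGadm⟩).1 t = G t := by
    have hl : Tendsto (fun n => (X (n + 1)).1 t) atTop (𝓝 (G t)) :=
      (hG t ht).comp (tendsto_add_atTop_nat 1)
    refine tendsto_nhds_unique ?_ hl
    rw [tendsto_iff_norm_sub_tendsto_zero]
    have h0 : Tendsto (fun n : ℕ => 2 * M * t ^ (-(1 / 4) : ℝ) * (1 / 2 : ℝ) ^ n) atTop (𝓝 0) := by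
      simpa using (tendsto_pow_atTop_nhds_zero_of_lt_one (by norm_num : (0 : ℝ) ≤ 1 / 2)
        (by norm_num)).const_mul (2 * M * t ^ (-(1 / 4) : ℝ))
    refine squeeze_zero (fun _ => norm_nonneg _) (fun n => ?_) h0
    rw [hXs n]
    refine (hlip (X n).2 hGadm (hΦ _) (hΦ ⟨G, hGadm⟩)
      (D := 4 * M * (1 / 2) ^ n) (by positivity) (hGdist n) t ht).trans_eq ?_
    ring
  rw [← hfix]
  exact (hΦ ⟨G, hGadm⟩).grad t ht

/-- Two solutions that overlap on an interval of positive length can be glued. -/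
theorem IsCoeffSolution.glue (hκ : 0 < κ) (h2 : 2 < p) (h3 : p < 3) (hM : 0 ≤ M)
    {t₀ t₂ δ M' : ℝ} {v : ℝ → L2} {H : ℝ → V2} (hM' : 0 ≤ M') (h0 : 0 ≤ t₀) (h02 : t₀ < t₂)
    (hδ : t₂ ≤ t₀ + δ) (h : IsCoeffSolution κ p t₂ M u₀ u G)
    (h' : IsCoeffSolution κ p δ M' (u t₀) v H) :
    ∃ M'' w K, 0 ≤ M'' ∧ IsCoeffSolution κ p (t₀ + δ) M'' u₀ w K := by
  have hsh := h.shift hM h0 h02.le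
  have hvu : ∀ t ∈ Icc 0 (t₂ - t₀), u (t₀ + t) = v t :=
    hsh.eq hκ h2 h3 hM (h'.mono_time (by linarith) (by linarith))
  -- On the overlap both fields are weak gradients of the same function, hence equal in `L²`.
  have hHG : ∀ t ∈ Ioc 0 (t₂ - t₀), G (t₀ + t) = H t := by
    intro t ht
    have h1 := hsh.step.grad t ht
    have h4 := h'.step.grad t ⟨ht.1, by linarith [ht.2]⟩
    rw [← hvu t (Ioc_subset_Icc_self ht)] at h4
    exact Lp.ext (h1.ae_eq h4)
  let w : ℝ → L2 := fun t => if t ≤ t₂ then u t else v (t - t₀)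
  let K : ℝ → V2 := fun t => if t ≤ t₂ then G t else H (t - t₀)
  have hwu : ∀ t ≤ t₂, w t = u t := fun t ht => if_pos ht
  have hKG : ∀ t ≤ t₂, K t = G t := fun t ht => if_pos ht
  have hwv : ∀ t, 0 ≤ t → w (t₀ + t) = v t := by
    intro t ht
    rcases le_or_gt (t₀ + t) t₂ with h5 | h5
    · rw [hwu _ h5, hvu t ⟨ht, by linarith⟩]
    · simp only [w, if_neg (not_le.2 h5), add_sub_cancel_left]
  have hKH : ∀ t, 0 < t → K (t₀ + t) = H t := by
    intro t ht
    rcases le_or_gt (t₀ + t) t₂ with h5 | h5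
    · rw [hKG _ h5, hHG t ⟨ht, by linarith⟩]
    · simp only [K, if_neg (not_le.2 h5), add_sub_cancel_left]
  have ht₂ : 0 < t₂ := h0.trans_lt h02
  have hgap : 0 < t₂ - t₀ := sub_pos.2 h02
  have hend : 0 < t₀ + δ := ht₂.trans_le hδ
  have hgap4 : 0 ≤ (t₂ - t₀) ^ (-(1 / 4) : ℝ) := Real.rpow_nonneg hgap.le _
  have hend4 : 0 ≤ (t₀ + δ) ^ (1 / 4 : ℝ) := Real.rpow_nonneg hend.le _
  -- This is what the overlap is for: `H` is used alone only for `t > t₂`, where `t - t₀` exceeds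
  -- the gap and the singularity of `H` at its own initial time is not seen. The last factor
  -- restores the weight `t^(-1/4)` on `(0, t₀ + δ]`.
  set M₂ := M' * (t₂ - t₀) ^ (-(1 / 4) : ℝ) * (t₀ + δ) ^ (1 / 4 : ℝ) with hM₂
  have hint : ∀ k, IntervalIntegrable (fun s => divFlux p (K s) k) volume 0 (t₀ + δ) := by
    intro k
    have i1 : IntervalIntegrable (fun s => divFlux p (K s) k) volume 0 t₂ := by
      refine (h.admissible.integrable k).congr fun s hs => ?_
      rw [uIoc_of_le ht₂.le] at hs
      simp only [hKG s hs.2]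
    have i2 : IntervalIntegrable (fun s => divFlux p (K s) k) volume t₀ (t₀ + δ) := by
      have := (h'.admissible.integrable k).comp_sub_right t₀
      rw [zero_add, add_comm δ] at this
      refine this.congr fun s hs => ?_
      rw [uIoc_of_le (by linarith)] at hs
      have := hKH (s - t₀) (by linarith [hs.1])
      rw [add_sub_cancel] at this
      simp only [this]
    refine i1.trans (i2.mono_set ?_)
    rw [uIcc_of_le hδ, uIcc_of_le (by linarith)]
    exact Icc_subset_Icc_left h02.le
  refine ⟨max M M₂, w, K, hM.trans (le_max_left _ _), ⟨fun t ht => ?_, hint⟩,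
    fun t ht => ?_, fun t ht k => ?_⟩
  · have h4 : 0 ≤ t ^ (-(1 / 4) : ℝ) := Real.rpow_nonneg ht.1.le _
    rcases le_or_gt t t₂ with h5 | h5
    · rw [hKG t h5]
      exact (h.admissible.bound t ⟨ht.1, h5⟩).trans
        (mul_le_mul_of_nonneg_right (le_max_left _ _) h4)
    · refine le_trans ?_ (mul_le_mul_of_nonneg_right (le_max_right M M₂) h4)
      have e : K t = H (t - t₀) := if_neg (not_le.2 h5)
      rw [e]
      refine (h'.admissible.bound (t - t₀) ⟨by linarith, by linarith [ht.2]⟩).trans ?_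
      have b1 : (t - t₀) ^ (-(1 / 4) : ℝ) ≤ (t₂ - t₀) ^ (-(1 / 4) : ℝ) :=
        Real.rpow_le_rpow_of_nonpos hgap (by linarith) (by norm_num)
      have b2 : 1 ≤ (t₀ + δ) ^ (1 / 4 : ℝ) * t ^ (-(1 / 4) : ℝ) := by
        have : t ^ (1 / 4 : ℝ) ≤ (t₀ + δ) ^ (1 / 4 : ℝ) :=
          Real.rpow_le_rpow ht.1.le ht.2 (by norm_num)
        calc (1 : ℝ) = t ^ (1 / 4 : ℝ) * t ^ (-(1 / 4) : ℝ) := by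
              rw [← Real.rpow_add ht.1]; norm_num
          _ ≤ _ := by gcongr
      calc _ ≤ M' * (t₂ - t₀) ^ (-(1 / 4) : ℝ) := by gcongr
        _ ≤ M' * (t₂ - t₀) ^ (-(1 / 4) : ℝ) *
            ((t₀ + δ) ^ (1 / 4 : ℝ) * t ^ (-(1 / 4) : ℝ)) :=
            le_mul_of_one_le_right (by positivity) b2
        _ = _ := by rw [hM₂]; ring
  · rcases le_or_gt t t₂ with h5 | h5
    · rw [hKG t h5, hwu t h5]
      exact h.step.grad t ⟨ht.1, h5⟩
    · have e1 := hKH (t - t₀) (by linarith)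
      have e2 := hwv (t - t₀) (by linarith)
      rw [add_sub_cancel] at e1 e2
      rw [e1, e2]
      exact h'.step.grad (t - t₀) ⟨by linarith, by linarith [ht.2]⟩
  · rcases le_or_gt t t₂ with h5 | h5
    · rw [hwu t h5, h.step.eq t ⟨ht.1, h5⟩]
      congr 1
      refine duhamel_congr ht.1 fun s hs => ?_
      rw [hKG s (hs.2.trans h5)]
    -- Beyond the overlap the Duhamel integral is split at `t₀`: the first part rebuilds the
    -- evolution of `u t₀`, the second is the Duhamel term of `v`.
    · obtain ⟨r, rfl⟩ : ∃ r, t = t₀ + r := ⟨t - t₀, by ring⟩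
      have hr : 0 ≤ r := by linarith
      have hi : IntervalIntegrable (fun s => divFlux p (K s) k) volume 0 (t₀ + r) :=
        (hint k).mono_set (by
          rw [uIcc_of_le ht.1, uIcc_of_le hend.le]
          exact Icc_subset_Icc_right ht.2)
      have d1 : duhamel κ (fun s => divFlux p (K s)) t₀ k =
          duhamel κ (fun s => divFlux p (G s)) t₀ k := duhamel_congr h0 fun s hs => by
        rw [hKG s (hs.2.trans h02.le)]
      have d2 : duhamel κ (fun s => divFlux p (K (t₀ + s))) r k =
          duhamel κ (fun s => divFlux p (H s)) r k := duhamel_congr hr fun s hs => by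
        rw [hKH s hs.1]
      rw [hwv r hr, h'.step.eq r ⟨hr, by linarith [ht.2]⟩, h.step.eq t₀ ⟨h0, h02.le⟩,
        duhamel_add (φ := fun s => divFlux p (K s)) h0 hr hi, d1, d2, add_comm t₀ r, heat_add]
      push_cast
      ring

end

/-! ### The maximal solution and the blow-up criterion. -/

section

variable {κ p : ℝ} {u₀ : L2}

theorem IsMildSolutionInS.mono (hκ : 0 < κ) (h2 : 2 < p) (h3 : p < 3) {T T' : ℝ} {u : ℝ → L2}
    (h0 : 0 ≤ T') (hT : T' ≤ T) (h : IsMildSolutionInS κ p T u₀ u) :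
    IsMildSolutionInS κ p T' u₀ u := by
  obtain ⟨M, G, hM, hG⟩ := h.exists_isCoeffSolution hκ h2 h3 (h0.trans hT)
  exact (hG.mono_time h0 hT).isMildSolutionInS hκ h2 h3 hM h0

theorem IsMildSolutionInS.congr (hκ : 0 < κ) (h2 : 2 < p) (h3 : p < 3) {T : ℝ} {u v : ℝ → L2}
    (hT : 0 ≤ T) (h : IsMildSolutionInS κ p T u₀ u) (huv : ∀ t ∈ Icc 0 T, v t = u t) :
    IsMildSolutionInS κ p T u₀ v := by
  obtain ⟨M, G, hM, hG⟩ := h.exists_isCoeffSolution hκ h2 h3 hT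
  exact (hG.congr huv).isMildSolutionInS hκ h2 h3 hM hT

/-- Uniqueness of mild solutions. -/
theorem IsMildSolutionInS.eq (hκ : 0 < κ) (h2 : 2 < p) (h3 : p < 3) {T T' : ℝ} {u v : ℝ → L2}
    (hu : IsMildSolutionInS κ p T u₀ u) (hv : IsMildSolutionInS κ p T' u₀ v) {t : ℝ} (ht : 0 ≤ t)
    (hT : t ≤ T) (hT' : t ≤ T') : u t = v t := by
  obtain ⟨M, G, hM, hG⟩ := (hu.mono hκ h2 h3 ht hT).exists_isCoeffSolution hκ h2 h3 ht
  obtain ⟨M', G', hM', hG'⟩ := (hv.mono hκ h2 h3 ht hT').exists_isCoeffSolution hκ h2 h3 ht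
  exact hG.eq hκ h2 h3 hM hG' t ⟨ht, le_rfl⟩

theorem le_maximalTime {T : ℝ} {u : ℝ → L2} (hT : 0 < T) (h : IsMildSolutionInS κ p T u₀ u) :
    ENNReal.ofReal T ≤ maximalTime κ p u₀ :=
  le_iSup₂ (f := fun T (_ : T ∈ {T : ℝ | 0 < T ∧ ∃ u : ℝ → L2, IsMildSolutionInS κ p T u₀ u}) =>
    ENNReal.ofReal T) T ⟨hT, u, h⟩

theorem exists_of_lt_maximalTime {t : ℝ} (h : ENNReal.ofReal t < maximalTime κ p u₀) :
    ∃ T, 0 < T ∧ t < T ∧ ∃ u, IsMildSolutionInS κ p T u₀ u := by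
  unfold maximalTime at h
  rw [lt_iSup_iff] at h
  obtain ⟨T, hT⟩ := h
  rw [lt_iSup_iff] at hT
  obtain ⟨⟨hT0, u, hu⟩, hlt⟩ := hT
  exact ⟨T, hT0, (ENNReal.ofReal_lt_ofReal_iff hT0).1 hlt, u, hu⟩

theorem exists_isMildSolutionInS (hκ : 0 < κ) (h2 : 2 < p) (h3 : p < 3) (u₀ : L2) :
    ∃ T, 0 < T ∧ ∃ u, IsMildSolutionInS κ p T u₀ u := by
  obtain ⟨δ, M, hδ, hM, h⟩ := exists_isCoeffSolution hκ h2 h3 (norm_nonneg u₀)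
  obtain ⟨u, G, hu⟩ := h u₀ le_rfl
  exact ⟨δ, hδ, u, hu.isMildSolutionInS hκ h2 h3 hM hδ.le⟩

theorem maximalTime_pos (hκ : 0 < κ) (h2 : 2 < p) (h3 : p < 3) (u₀ : L2) :
    0 < maximalTime κ p u₀ := by
  obtain ⟨T, hT, u, hu⟩ := exists_isMildSolutionInS hκ h2 h3 u₀
  exact (ENNReal.ofReal_pos.2 hT).trans_le (le_maximalTime hT hu)

/-- By uniqueness the value at time `t` is the same for all solutions that reach `t`, so one
function can be chosen pointwise; where no solution exists the value is irrelevant. -/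
theorem exists_isMaximalMildSolution (hκ : 0 < κ) (h2 : 2 < p) (h3 : p < 3) (u₀ : L2) :
    ∃ u, IsMaximalMildSolution κ p u₀ u := by
  have key : ∀ t : ℝ, ∃ x : L2, ∀ (T : ℝ) (v : ℝ → L2), 0 ≤ t → t ≤ T →
      IsMildSolutionInS κ p T u₀ v → v t = x := by
    intro t
    by_cases h : ∃ (T : ℝ) (v : ℝ → L2), 0 ≤ t ∧ t ≤ T ∧ IsMildSolutionInS κ p T u₀ v
    · obtain ⟨T, v, h0, hT, hv⟩ := h
      exact ⟨v t, fun T' v' _ hT' hv' => hv'.eq hκ h2 h3 hv h0 hT' hT⟩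
    · exact ⟨0, fun T v h0 hT hv => absurd ⟨T, v, h0, hT, hv⟩ h⟩
  choose u hu using key
  refine ⟨u, fun T hT hlt => ?_⟩
  obtain ⟨T', -, hTT', v, hv⟩ := exists_of_lt_maximalTime hlt
  exact (hv.mono hκ h2 h3 hT.le hTT'.le).congr hκ h2 h3 hT.le fun t ht =>
    (hu t T' v ht.1 (ht.2.trans hTT'.le) hv).symm

theorem IsMaximalMildSolution.eq (hκ : 0 < κ) (h2 : 2 < p) (h3 : p < 3) {u v : ℝ → L2}
    (hu : IsMaximalMildSolution κ p u₀ u) (hv : IsMaximalMildSolution κ p u₀ v) {t : ℝ}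
    (ht : 0 ≤ t) (hlt : ENNReal.ofReal t < maximalTime κ p u₀) : v t = u t := by
  obtain ⟨T, hT, htT, w, hw⟩ := exists_of_lt_maximalTime hlt
  -- A strictly later time is used because `t = 0` is allowed, whereas `IsMaximalMildSolution`
  -- speaks of positive times only.
  have hmid : ENNReal.ofReal ((t + T) / 2) < maximalTime κ p u₀ :=
    ((ENNReal.ofReal_lt_ofReal_iff hT).2 (by linarith)).trans_le (le_maximalTime hT hw)
  exact (hv _ (by linarith) hmid).eq hκ h2 h3 (hu _ (by linarith) hmid) ht (by linarith)
    (by linarith)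

/-- The blow-up criterion: the `L²` norm is unbounded near a finite maximal time. -/
theorem IsMaximalMildSolution.limsup_eq_top (hκ : 0 < κ) (h2 : 2 < p) (h3 : p < 3) {u : ℝ → L2}
    (hu : IsMaximalMildSolution κ p u₀ u) (hfin : maximalTime κ p u₀ ≠ ⊤) :
    limsup (fun t : ℝ => ‖u t‖ₑ) (𝓝[<] (maximalTime κ p u₀).toReal) = ⊤ := by
  set S := (maximalTime κ p u₀).toReal with hS
  have hS0 : 0 < S := ENNReal.toReal_pos (maximalTime_pos hκ h2 h3 u₀).ne' hfin
  have hSeq : maximalTime κ p u₀ = ENNReal.ofReal S := (ENNReal.ofReal_toReal hfin).symm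
  by_contra hne
  -- A finite limit superior bounds the norm by a single `R` near `S`, and `R` fixes a lifespan `δ`
  -- before the restart time is chosen.
  obtain ⟨R, hR1, hR2⟩ := ENNReal.lt_iff_exists_nnreal_btwn.1 (lt_top_iff_ne_top.2 hne)
  have hev : ∀ᶠ t in 𝓝[<] S, ‖u t‖ₑ < R := eventually_lt_of_limsup_lt hR1
  obtain ⟨δ, M', hδ, hM', hloc⟩ := exists_isCoeffSolution hκ h2 h3 R.2
  have hIoo : Ioo (max 0 (S - δ)) S ∈ 𝓝[<] S :=
    Ioo_mem_nhdsLT (max_lt hS0 (by linarith))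
  obtain ⟨t₀, ht₀, hmem⟩ := (hev.and hIoo).exists
  have h00 : 0 < t₀ := (le_max_left _ _).trans_lt hmem.1
  have h0δ : S - δ < t₀ := (le_max_right _ _).trans_lt hmem.1
  have hnorm : ‖u t₀‖ ≤ R := by
    have : ‖u t₀‖₊ < R := by exact_mod_cast ht₀
    exact_mod_cast this.le
  obtain ⟨v, H, hv⟩ := hloc (u t₀) hnorm
  -- The maximal solution is available only strictly before `S`, so the overlap required for gluing
  -- ends halfway between `t₀` and `S`.
  set t₂ := (t₀ + S) / 2 with ht₂
  have h02 : t₀ < t₂ := by linarith [hmem.2]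
  have h2S : t₂ < S := by linarith [hmem.2]
  have hlt : ENNReal.ofReal t₂ < maximalTime κ p u₀ := by
    rw [hSeq]
    exact (ENNReal.ofReal_lt_ofReal_iff hS0).2 h2S
  obtain ⟨M, G, hM, hG⟩ := (hu t₂ (by linarith) hlt).exists_isCoeffSolution hκ h2 h3 (by linarith)
  obtain ⟨M'', w, K, hM'', hw⟩ := hG.glue hκ h2 h3 hM hM' h00.le h02 (by linarith) hv
  have hend : 0 < t₀ + δ := by linarith
  -- The glued solution lives up to `t₀ + δ`, which exceeds `S` because `t₀ > S - δ`.
  have hle := le_maximalTime hend (hw.isMildSolutionInS hκ h2 h3 hM'' hend.le)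
  rw [hSeq, ENNReal.ofReal_le_ofReal_iff hS0.le] at hle
  linarith

end

end ThinFilm

end

theorem mainTheorem5 (κ p : ℝ) (hκ : 0 < κ) (hp₂ : 2 < p) (hp₃ : p < 3) (u₀ : ThinFilm.L2) :
    0 < ThinFilm.maximalTime κ p u₀ ∧
    ∃ u : ℝ → ThinFilm.L2,
      ThinFilm.IsMaximalMildSolution κ p u₀ u ∧
      (∀ v : ℝ → ThinFilm.L2, ThinFilm.IsMaximalMildSolution κ p u₀ v →
        ∀ t : ℝ, 0 ≤ t → ENNReal.ofReal t < ThinFilm.maximalTime κ p u₀ → v t = u t) ∧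
      (ThinFilm.maximalTime κ p u₀ ≠ ⊤ →
        limsup (fun t : ℝ => ‖u t‖ₑ) (𝓝[<] (ThinFilm.maximalTime κ p u₀).toReal) = ⊤) := by
  obtain ⟨u, hu⟩ := ThinFilm.exists_isMaximalMildSolution hκ hp₂ hp₃ u₀
  exact ⟨ThinFilm.maximalTime_pos hκ hp₂ hp₃ u₀, u, hu,
    fun v hv t ht hlt => hu.eq hκ hp₂ hp₃ hv ht hlt, hu.limsup_eq_top hκ hp₂ hp₃⟩
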